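/- Let $(\mathrm{ST}_h)_{h\in\mathbf Z}$ be independent real random variables on a probability space $\Omega$, each distributed according to the Sato–Tate measure $\frac1\pi\sqrt{1-(x/2)^2}\,dx$ on $[-2,2]$. For $t\in[0,1]$ and an integer $m\ge 0$ put $$\mathrm K_m(t)=\sum_{|h|<m}\frac{e^{2i\pi ht}-1}{2i\pi h}\,\mathrm{ST}_h,$$ where the term $h=0$ is interpreted as $t\,\mathrm{ST}_0$, and let $\mathrm K(t)$ be the pointwise limit of $\mathrm K_m(t)$ as $m\to+\infty$ (with an arbitrary constant value where the limit does not exist). (1) For every $t\in[0,1]$, $\mathrm K_m(t)$ converges to $\mathrm K(t)$ almost surely, in law, and in $L^q(\Omega)$ for every $1\le q<+\infty$. Moreover there is an absolute constant $C>0$, independent of $t$, $m$, $\Omega$ and the $\mathrm{ST}_h$, such that $$\|\mathrm K_m(t)\|_{L^\infty(\Omega)}\le C\log m\quad(m\ge 2),\qquad \mathbf E(|\mathrm K(t)-\mathrm K_m(t)|)\le C\,m^{-1/2}\quad(m\ge 1).$$ (2) For every $t\in[0,1]$ and all real $\lambda,\nu\ge 0$, the Laplace transform $\mathbf E\bigl(e^{\lambda\,\mathrm{Re}\,\mathrm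 K(t)+\nu\,\mathrm{Im}\,\mathrm K(t)}\bigr)$ is well-defined (the random variable is integrable), and $\mathrm K(t)$ has moments of all orders. (3) Almost surely, the function $t\mapsto\mathrm K(t)$ is continuous on $[0,1]$ and nowhere differentiable on $[0,1]$ (one-sided derivatives being meant at the end points). (4) Almost surely, $t\mapsto \mathrm K(t)$ is Hölder continuous of every order $0<\alpha<1/2$ on $[0,1]$, and it is nowhere Hölder continuous of order $1/2$ in the following sense: its restriction to any interval $[a,b]\subset[0,1]$ with $a<b$ is not Hölder continuous of order $1/2$. Moreover, almost surely, there is no $t\in[0,1]$ such that $\mathrm K(s)-\mathrm K(t)=o(|s-t|^{1/2})$ as $s\to t$ in $[0,1]$. -/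

import Mathlib

open MeasureTheory ProbabilityTheory Filter Topology Set
open scoped ENNReal NNReal Asymptotics

noncomputable section

namespace KloostermanPaths

/-- The Sato-Tate measure `(1/π) √(1 - (x/2)²) dx` on `[-2, 2]`. -/
def satoTate : Measure ℝ :=
  (volume.restrict (Icc (-2 : ℝ) 2)).withDensity
    fun x => ENNReal.ofReal (1 / Real.pi * Real.sqrt (1 - (x / 2) ^ 2))

/-- `(ST h)`, for `h ∈ ℤ`, are independent real random variables on `(Ω, P)`, all distributed
according to the Sato-Tate measure. -/
structure IsSatoTateSequence {Ω : Type*} [MeasurableSpace Ω] (P : Measure Ω)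
    (ST : ℤ → Ω → ℝ) : Prop where
  measurable : ∀ h, Measurable (ST h)
  law : ∀ h, P.map (ST h) = satoTate
  indep : iIndepFun ST P

/-- The coefficient `(e^{2πiht} - 1) / (2πih)`, interpreted as `t` for `h = 0`. -/
def coeff (h : ℤ) (t : ℝ) : ℂ :=
  if h = 0 then (t : ℂ)
  else (Complex.exp (2 * Real.pi * Complex.I * h * t) - 1) / (2 * Real.pi * Complex.I * h)

/-- The symmetric partial sum `K_m(t) = ∑_{|h| < m} (e^{2πiht} - 1) / (2πih) ST_h`. -/
def partialSum {Ω : Type*} (ST : ℤ → Ω → ℝ) (m : ℕ) (t : ℝ) (ω : Ω) : ℂ :=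
  ∑ h ∈ Finset.Ioo (-(m : ℤ)) (m : ℤ), coeff h t * (ST h ω : ℂ)

/-- The random series `K(t)`: the pointwise limit of the symmetric partial sums
(with an irrelevant constant value where they do not converge). -/
def K {Ω : Type*} (ST : ℤ → Ω → ℝ) (t : ℝ) (ω : Ω) : ℂ :=
  limUnder atTop fun m : ℕ => partialSum ST m t ω

end KloostermanPaths

end

namespace KloostermanPaths

theorem satoTate_absolutelyContinuous : satoTate ≪ volume :=
  (withDensity_absolutelyContinuous _ _).trans Measure.restrict_le_self.absolutelyContinuous

theorem ae_satoTate_mem_Icc : ∀ᵐ x ∂satoTate, x ∈ Icc (-2 : ℝ) 2 :=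
  (withDensity_absolutelyContinuous _ _).ae_le (ae_restrict_mem measurableSet_Icc)

theorem satoTate_map_neg : satoTate.map (fun x => -x) = satoTate := by
  have hmeas : Measurable fun x : ℝ =>
      ENNReal.ofReal (1 / Real.pi * Real.sqrt (1 - (x / 2) ^ 2)) := by fun_prop
  ext s hs
  rw [Measure.map_apply measurable_neg hs, satoTate, withDensity_apply _ hs,
    withDensity_apply _ (measurable_neg hs), Measure.restrict_restrict hs,
    Measure.restrict_restrict (measurable_neg hs),
    ← lintegral_indicator (hs.inter measurableSet_Icc),
    ← lintegral_indicator ((measurable_neg hs).inter measurableSet_Icc),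
    ← lintegral_neg_eq_self]
  congr 1
  ext x
  by_cases h : x ∈ s ∩ Icc (-2 : ℝ) 2
  · have h' : -x ∈ ((fun x : ℝ => -x) ⁻¹' s) ∩ Icc (-2 : ℝ) 2 := by
      refine ⟨by simpa using h.1, ?_, ?_⟩ <;> linarith [h.2.1, h.2.2]
    rw [indicator_of_mem h, indicator_of_mem h']
    simp [neg_div]
  · have h' : -x ∉ ((fun x : ℝ => -x) ⁻¹' s) ∩ Icc (-2 : ℝ) 2 := by
      rintro ⟨h1, h2, h3⟩
      exact h ⟨by simpa using h1, by linarith, by linarith⟩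
    rw [indicator_of_notMem h, indicator_of_notMem h']

theorem integral_id_satoTate : ∫ x, x ∂satoTate = 0 := by
  have h : ∫ x, x ∂satoTate = ∫ x, -x ∂satoTate := by
    conv_lhs => rw [← satoTate_map_neg]
    exact integral_map measurable_neg.aemeasurable
      (measurable_id.aestronglyMeasurable)
  rw [integral_neg] at h
  linarith

/-- The variance of the Sato-Tate measure. -/
noncomputable def satoTateVar : ℝ := ∫ x, x ^ 2 ∂satoTate

theorem satoTateVar_pos [IsProbabilityMeasure satoTate] : 0 < satoTateVar := by
  have hint : Integrable (fun x : ℝ => x ^ 2) satoTate := by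
    refine Integrable.of_bound (by fun_prop) 4 ?_
    filter_upwards [ae_satoTate_mem_Icc] with x hx
    rw [Real.norm_eq_abs, abs_of_nonneg (sq_nonneg x)]
    nlinarith [hx.1, hx.2]
  refine lt_of_le_of_ne (integral_nonneg fun x => sq_nonneg x) fun h => ?_
  have h0 := (integral_eq_zero_iff_of_nonneg (fun x => sq_nonneg x) hint).1 h.symm
  have h1 : ∀ᵐ x ∂satoTate, x ≠ 0 := by
    have : satoTate {(0 : ℝ)} = 0 := satoTate_absolutelyContinuous (by simp)
    simpa [ae_iff] using this
  have h2 : ∀ᵐ x ∂satoTate, False := by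
    filter_upwards [h0, h1] with x hx hx'
    exact hx' (by simpa using hx)
  have : satoTate univ = 0 := by
    rw [ae_iff] at h2
    simp at h2
  simp at this

namespace IsSatoTateSequence

variable {Ω : Type*} [MeasurableSpace Ω] {P : Measure Ω} {ST : ℤ → Ω → ℝ}

theorem isProbabilityMeasure_satoTate [IsProbabilityMeasure P]
    (hST : IsSatoTateSequence P ST) :
    IsProbabilityMeasure satoTate := by
  rw [← hST.law 0]
  exact Measure.isProbabilityMeasure_map (hST.measurable 0).aemeasurable

theorem ae_mem_Icc (hST : IsSatoTateSequence P ST) (h : ℤ) :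
    ∀ᵐ ω ∂P, ST h ω ∈ Icc (-2 : ℝ) 2 := by
  have := ae_satoTate_mem_Icc
  rw [← hST.law h] at this
  exact ae_of_ae_map (hST.measurable h).aemeasurable this

theorem ae_abs_le (hST : IsSatoTateSequence P ST) : ∀ᵐ ω ∂P, ∀ h, |ST h ω| ≤ 2 := by
  rw [ae_all_iff]
  intro h
  filter_upwards [hST.ae_mem_Icc h] with ω hω
  exact abs_le.2 hω

theorem integral_eq_zero (hST : IsSatoTateSequence P ST) (h : ℤ) : ∫ ω, ST h ω ∂P = 0 := by
  rw [← integral_id_satoTate, ← hST.law h]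
  exact (integral_map (hST.measurable h).aemeasurable measurable_id.aestronglyMeasurable).symm

theorem integral_sq (hST : IsSatoTateSequence P ST) (h : ℤ) :
    ∫ ω, ST h ω ^ 2 ∂P = satoTateVar := by
  rw [satoTateVar, ← hST.law h]
  exact (integral_map (hST.measurable h).aemeasurable
    (measurable_id.pow_const 2).aestronglyMeasurable).symm

theorem iIndepFun_mul (hST : IsSatoTateSequence P ST) (a : ℤ → ℝ) :
    iIndepFun (fun h ω => a h * ST h ω) P :=
  hST.indep.comp (fun h x => a h * x) fun h => measurable_const_mul (a h)

variable [IsProbabilityMeasure P]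

theorem hasSubgaussianMGF (hST : IsSatoTateSequence P ST) (h : ℤ) :
    HasSubgaussianMGF (ST h) 4 P := by
  have := hasSubgaussianMGF_of_mem_Icc_of_integral_eq_zero (hST.measurable h).aemeasurable
    (hST.ae_mem_Icc h) (hST.integral_eq_zero h)
  convert this using 1
  ext
  norm_num

theorem hasSubgaussianMGF_sum (hST : IsSatoTateSequence P ST) (s : Finset ℤ) (a : ℤ → ℝ) :
    HasSubgaussianMGF (fun ω => ∑ h ∈ s, a h * ST h ω)
      (Real.toNNReal (4 * ∑ h ∈ s, a h ^ 2)) P := by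
  have h1 : Real.toNNReal (4 * ∑ h ∈ s, a h ^ 2) = ∑ h ∈ s, Real.toNNReal (a h ^ 2) * 4 := by
    ext
    rw [Real.coe_toNNReal _ (mul_nonneg (by norm_num) (Finset.sum_nonneg fun h _ => sq_nonneg _)),
      NNReal.coe_sum, Finset.mul_sum]
    refine Finset.sum_congr rfl fun h _ => ?_
    rw [NNReal.coe_mul, Real.coe_toNNReal _ (sq_nonneg _), mul_comm]
    rfl
  rw [h1]
  refine HasSubgaussianMGF.sum_of_iIndepFun (hST.iIndepFun_mul a) fun h _ => ?_
  rw [Real.toNNReal_of_nonneg (sq_nonneg _)]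
  exact (hST.hasSubgaussianMGF h).const_mul (a h)

theorem integrable_exp_sum (hST : IsSatoTateSequence P ST) (s : Finset ℤ) (a : ℤ → ℝ) :
    Integrable (fun ω => Real.exp (∑ h ∈ s, a h * ST h ω)) P := by
  simpa using (hST.hasSubgaussianMGF_sum s a).integrable_exp_mul 1

theorem integral_exp_sum_le (hST : IsSatoTateSequence P ST) (s : Finset ℤ) (a : ℤ → ℝ) :
    ∫ ω, Real.exp (∑ h ∈ s, a h * ST h ω) ∂P ≤ Real.exp (2 * ∑ h ∈ s, a h ^ 2) := by
  have h := (hST.hasSubgaussianMGF_sum s a).mgf_le 1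
  simp only [mgf, one_mul] at h
  refine h.trans (Real.exp_le_exp.2 (le_of_eq ?_))
  rw [Real.coe_toNNReal _ (mul_nonneg (by norm_num) (Finset.sum_nonneg fun h _ => sq_nonneg _))]
  ring

/-- Hoeffding's inequality for linear combinations. -/
theorem measureReal_abs_sum_ge_le (hST : IsSatoTateSequence P ST) (s : Finset ℤ) (a : ℤ → ℝ)
    {V : ℝ} (hV : ∑ h ∈ s, a h ^ 2 ≤ V) {x : ℝ} (hx : 0 ≤ x) :
    P.real {ω | x ≤ |∑ h ∈ s, a h * ST h ω|} ≤ 2 * Real.exp (-x ^ 2 / (8 * V)) := by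
  have h0 : HasSubgaussianMGF (fun ω => ∑ h ∈ s, a h * ST h ω) (Real.toNNReal (4 * V)) P := by
    refine ⟨(hST.hasSubgaussianMGF_sum s a).1, fun t =>
      ((hST.hasSubgaussianMGF_sum s a).2 t).trans (Real.exp_le_exp.2 ?_)⟩
    gcongr
  have h1 := h0.measure_ge_le hx
  have h2 := h0.neg.measure_ge_le hx
  have e : 2 * (Real.toNNReal (4 * V) : ℝ) = 8 * V := by
    rw [Real.coe_toNNReal _ (mul_nonneg (by norm_num)
      ((Finset.sum_nonneg fun h _ => sq_nonneg _).trans hV))]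
    ring
  rw [e] at h1 h2
  calc P.real {ω | x ≤ |∑ h ∈ s, a h * ST h ω|}
      ≤ P.real ({ω | x ≤ ∑ h ∈ s, a h * ST h ω} ∪
          {ω | x ≤ (-fun ω => ∑ h ∈ s, a h * ST h ω) ω}) := by
        refine measureReal_mono fun ω hω => ?_
        rcases le_abs.1 (show x ≤ |∑ h ∈ s, a h * ST h ω| from hω) with h | h
        · exact Or.inl h
        · exact Or.inr (by simpa using h)
    _ ≤ _ := measureReal_union_le _ _
    _ ≤ _ := by linarith

theorem le_integral_exp_mul (hST : IsSatoTateSequence P ST) (h : ℤ) {a : ℝ} (ha : |a| ≤ 1 / 2) :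
    Real.exp (a ^ 2 * satoTateVar / 8) ≤ ∫ ω, Real.exp (a * ST h ω) ∂P := by
  have hint (k : ℕ) : Integrable (fun ω => ST h ω ^ k) P := by
    refine Integrable.of_bound ((hST.measurable h).pow_const k).aestronglyMeasurable (2 ^ k) ?_
    filter_upwards [hST.ae_abs_le] with ω hω
    rw [norm_pow]
    exact pow_le_pow_left₀ (norm_nonneg _) (hω h) k
  have hint1 : Integrable (fun ω => ST h ω) P := by simpa using hint 1
  have hexp (x : ℝ) (hx : |x| ≤ 1) : 1 + x + x ^ 2 / 4 ≤ Real.exp x := by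
    have h3 := Real.exp_bound hx (n := 3) (by norm_num)
    have h4 : |x| ^ 3 ≤ x ^ 2 := by
      rw [← sq_abs]
      nlinarith [abs_nonneg x, sq_nonneg |x|]
    norm_num [Finset.sum_range_succ, Nat.factorial] at h3
    have := (abs_le.1 h3).1
    nlinarith [sq_nonneg x]
  have hv0 : 0 ≤ satoTateVar := integral_nonneg fun x => sq_nonneg x
  have hv4 : satoTateVar ≤ 4 := by
    rw [← hST.integral_sq h]
    calc ∫ ω, ST h ω ^ 2 ∂P ≤ ∫ _, (4 : ℝ) ∂P := by
          refine integral_mono_ae (hint 2) (integrable_const _) ?_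
          filter_upwards [hST.ae_abs_le] with ω hω
          have := abs_le.1 (hω h)
          nlinarith
      _ = 4 := by simp
  have ha2 : a ^ 2 ≤ 1 / 4 := by
    rw [← sq_abs]
    nlinarith [abs_nonneg a]
  calc Real.exp (a ^ 2 * satoTateVar / 8) ≤ 1 + a ^ 2 * satoTateVar / 4 := by
        set y := a ^ 2 * satoTateVar / 8 with hy
        have hy0 : 0 ≤ y := by positivity
        have hy1 : y ≤ 1 / 8 := by rw [hy]; nlinarith
        have := (abs_le.1 (Real.abs_exp_sub_one_sub_id_le (x := y)
          (by rw [abs_of_nonneg hy0]; linarith))).2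
        have e : a ^ 2 * satoTateVar / 4 = 2 * y := by rw [hy]; ring
        rw [e]
        nlinarith
    _ = ∫ ω, (1 + a * ST h ω + (a ^ 2 / 4) * ST h ω ^ 2) ∂P := by
        have e1 : Integrable (fun ω => a * ST h ω) P := hint1.const_mul _
        have e2 : Integrable (fun ω => 1 + a * ST h ω) P := (integrable_const _).add e1
        rw [integral_add e2 ((hint 2).const_mul _), integral_add (integrable_const _) e1, integral_const_mul,
          integral_const_mul, hST.integral_eq_zero, hST.integral_sq]
        simp
        ring
    _ ≤ ∫ ω, Real.exp (a * ST h ω) ∂P := by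
        refine integral_mono_ae (((integrable_const _).add (hint1.const_mul _)).add
          ((hint 2).const_mul _)) ((hST.hasSubgaussianMGF h).integrable_exp_mul a) ?_
        filter_upwards [hST.ae_abs_le] with ω hω
        have h5 : |a * ST h ω| ≤ 1 := by
          rw [abs_mul]
          nlinarith [hω h, abs_nonneg a, abs_nonneg (ST h ω)]
        refine le_trans (le_of_eq ?_) (hexp _ h5)
        ring

theorem le_integral_exp_sum (hST : IsSatoTateSequence P ST) (s : Finset ℤ) (a : ℤ → ℝ)
    (ha : ∀ h ∈ s, |a h| ≤ 1 / 2) :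
    Real.exp ((∑ h ∈ s, a h ^ 2) * satoTateVar / 8) ≤
      ∫ ω, Real.exp (∑ h ∈ s, a h * ST h ω) ∂P := by
  have h1 := (hST.iIndepFun_mul a).mgf_sum (t := 1)
    (fun h => (hST.measurable h).const_mul (a h)) s
  have h2 : ∫ ω, Real.exp (∑ h ∈ s, a h * ST h ω) ∂P =
      ∏ h ∈ s, ∫ ω, Real.exp (a h * ST h ω) ∂P := by
    simpa [mgf] using h1
  rw [h2, Finset.sum_mul, Finset.sum_div, Real.exp_sum]
  exact Finset.prod_le_prod (fun h _ => (Real.exp_pos _).le)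
    fun h hh => hST.le_integral_exp_mul h (ha h hh)

end IsSatoTateSequence
/-- The Paley-Zygmund inequality. -/
theorem paley_zygmund {Ω : Type*} [MeasurableSpace Ω] {P : Measure Ω} [IsProbabilityMeasure P]
    {Y : Ω → ℝ} (hY : Measurable Y) (hi : Integrable Y P) (hi2 : Integrable (fun ω => Y ω ^ 2) P)
    (hpos : 0 < ∫ ω, Y ω ∂P) :
    (∫ ω, Y ω ∂P) ^ 2 / (4 * ∫ ω, Y ω ^ 2 ∂P) ≤ P.real {ω | (∫ ω, Y ω ∂P) / 2 ≤ Y ω} := by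
  set m := ∫ ω, Y ω ∂P with hm
  set V := ∫ ω, Y ω ^ 2 ∂P with hV
  set A := {ω | m / 2 ≤ Y ω} with hA
  have hAm : MeasurableSet A := measurableSet_le measurable_const hY
  have hVpos : 0 < V := by
    have h1 : 0 ≤ ∫ ω, (Y ω - m) ^ 2 ∂P := integral_nonneg fun ω => sq_nonneg _
    have h2 : ∫ ω, (Y ω - m) ^ 2 ∂P = V - m ^ 2 := by
      have e : ∀ ω, (Y ω - m) ^ 2 = Y ω ^ 2 - (2 * m) * Y ω + m ^ 2 := fun ω => by ring
      have e1 : Integrable (fun ω => 2 * m * Y ω) P := hi.const_mul _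
      have e2 : Integrable (fun ω => Y ω ^ 2 - 2 * m * Y ω) P := hi2.sub e1
      simp_rw [e]
      rw [integral_add e2 (integrable_const _), integral_sub hi2 e1, integral_const_mul]
      simp
      rw [← hm]
      ring
    nlinarith
  set s := m / (2 * V) with hs
  have hspos : 0 < s := by positivity
  have hind : ∀ ω, Y ω ≤ m / 2 + s / 2 * Y ω ^ 2 + A.indicator (fun _ => 1 / (2 * s)) ω := by
    intro ω
    by_cases h : ω ∈ A
    · rw [indicator_of_mem h]
      have : 0 ≤ (s * Y ω - 1) ^ 2 / (2 * s) := by positivity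
      have e : (s * Y ω - 1) ^ 2 / (2 * s) = s / 2 * Y ω ^ 2 - Y ω + 1 / (2 * s) := by
        field_simp
        ring
      linarith
    · rw [indicator_of_notMem h]
      have h1 : Y ω < m / 2 := not_le.1 h
      have : 0 ≤ s / 2 * Y ω ^ 2 := by positivity
      linarith
  have e1 : Integrable (fun ω => m / 2 + s / 2 * Y ω ^ 2) P :=
    (integrable_const _).add (hi2.const_mul _)
  have e2 : Integrable (A.indicator fun _ => 1 / (2 * s)) P := (integrable_const _).indicator hAm
  have key : m ≤ m / 2 + s / 2 * V + P.real A * (1 / (2 * s)) := by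
    calc m ≤ ∫ ω, (m / 2 + s / 2 * Y ω ^ 2 + A.indicator (fun _ => 1 / (2 * s)) ω) ∂P :=
          integral_mono hi (e1.add e2) hind
      _ = _ := by
          rw [integral_add e1 e2, integral_add (integrable_const _) (hi2.const_mul _),
            integral_const_mul, integral_indicator_const _ hAm, ← hV]
          simp
  have e3 : s / 2 * V = m / 4 := by rw [hs]; field_simp; ring
  have e4 : P.real A * (1 / (2 * s)) = P.real A * V / m := by rw [hs]; field_simp
  rw [e3, e4] at key
  rw [div_le_iff₀ (by positivity)]
  have h5 : m / 4 ≤ P.real A * V / m := by linarith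
  rw [le_div_iff₀ hpos] at h5
  nlinarith

namespace IsSatoTateSequence

variable {Ω : Type*} [MeasurableSpace Ω] {P : Measure Ω} [IsProbabilityMeasure P] {ST : ℤ → Ω → ℝ}

theorem exists_le_measureReal_sum_ge (hST : IsSatoTateSequence P ST) (A : ℝ) :
    ∃ p > 0, ∃ η > 0, ∀ (s : Finset ℤ) (a : ℤ → ℝ) (τ : ℝ), 0 < τ → ∑ h ∈ s, a h ^ 2 = τ ^ 2 →
      (∀ h ∈ s, |a h| ≤ η * τ) → p ≤ P.real {ω | A * τ ≤ ∑ h ∈ s, a h * ST h ω} := by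
  have := hST.isProbabilityMeasure_satoTate
  have hv := satoTateVar_pos
  set v := satoTateVar with hv_def
  set L : ℝ := 8 * (|A| + 1) / v + 1 with hL
  have hL1 : 1 ≤ L := by
    have : 0 ≤ 8 * (|A| + 1) / v := by positivity
    linarith
  have hLA : A + 1 ≤ L * v / 8 := by
    have : L * v / 8 = |A| + 1 + v / 8 := by rw [hL]; field_simp
    linarith [le_abs_self A]
  refine ⟨Real.exp (-(8 * L ^ 2)) / 4, by positivity, 1 / (2 * L), by positivity, ?_⟩
  intro s a τ hτ hsum hsmall
  set b : ℤ → ℝ := fun h => L / τ * a h with hb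
  have hbs : ∑ h ∈ s, b h ^ 2 = L ^ 2 := by
    simp only [hb, mul_pow]
    rw [← Finset.mul_sum, hsum]
    field_simp
  have hbsmall : ∀ h ∈ s, |b h| ≤ 1 / 2 := by
    intro h hh
    simp only [hb]
    rw [abs_mul, abs_of_pos (by positivity : 0 < L / τ)]
    calc L / τ * |a h| ≤ L / τ * (1 / (2 * L) * τ) := by gcongr; exact hsmall h hh
      _ = 1 / 2 := by field_simp
  set Y : Ω → ℝ := fun ω => Real.exp (∑ h ∈ s, b h * ST h ω) with hY
  have hYm : Measurable Y :=
    Real.measurable_exp.comp (Finset.measurable_sum _ fun h _ => (hST.measurable h).const_mul _)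
  have hY2 : ∀ ω, Y ω ^ 2 = Real.exp (∑ h ∈ s, (2 * b h) * ST h ω) := by
    intro ω
    simp only [hY]
    rw [← Real.exp_nat_mul, Finset.mul_sum]
    congr 1
    refine Finset.sum_congr rfl fun h _ => ?_
    push_cast
    ring
  have hlow := hST.le_integral_exp_sum s b hbsmall
  have hup := hST.integral_exp_sum_le s fun h => 2 * b h
  have hi := hST.integrable_exp_sum s b
  have hi2 := hST.integrable_exp_sum s fun h => 2 * b h
  simp_rw [← hY2] at hup hi2
  change Real.exp _ ≤ ∫ ω, Y ω ∂P at hlow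
  rw [hbs] at hlow
  have hsum4 : ∑ h ∈ s, (2 * b h) ^ 2 = 4 * L ^ 2 := by
    simp only [mul_pow]
    rw [← Finset.mul_sum, hbs]
    norm_num
  rw [hsum4] at hup
  have hm1 : 1 ≤ ∫ ω, Y ω ∂P :=
    le_trans (Real.one_le_exp (by positivity)) hlow
  have hpz := paley_zygmund hYm hi hi2 (by linarith)
  have hVpos : 0 < ∫ ω, Y ω ^ 2 ∂P := by
    simp_rw [hY2]
    exact integral_exp_pos (by simpa [hY2] using hi2)
  refine le_trans (le_trans ?_ hpz) (measureReal_mono ?_)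
  · rw [le_div_iff₀ (by positivity)]
    have : Real.exp (-(8 * L ^ 2)) * (∫ ω, Y ω ^ 2 ∂P) ≤ 1 := by
      calc Real.exp (-(8 * L ^ 2)) * (∫ ω, Y ω ^ 2 ∂P)
          ≤ Real.exp (-(8 * L ^ 2)) * Real.exp (2 * (4 * L ^ 2)) := by gcongr
        _ = 1 := by rw [← Real.exp_add]; simp; ring
    nlinarith
  · intro ω hω
    have h1 : Real.exp (L ^ 2 * v / 8) / 2 ≤ Y ω := le_trans (by gcongr) hω
    have h2 : Real.exp (L ^ 2 * v / 8 - 1) ≤ Y ω := by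
      refine le_trans ?_ h1
      rw [Real.exp_sub]
      gcongr
      have := Real.add_one_le_exp (1 : ℝ)
      linarith
    have h3 : L ^ 2 * v / 8 - 1 ≤ ∑ h ∈ s, b h * ST h ω := Real.exp_le_exp.1 h2
    have h4 : ∑ h ∈ s, b h * ST h ω = L / τ * ∑ h ∈ s, a h * ST h ω := by
      rw [Finset.mul_sum]
      refine Finset.sum_congr rfl fun h _ => ?_
      simp only [hb]
      ring
    have h5 : L * A ≤ L / τ * ∑ h ∈ s, a h * ST h ω := by
      rw [← h4]
      nlinarith
    change A * τ ≤ ∑ h ∈ s, a h * ST h ω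
    have h6 : L * A = L / τ * (A * τ) := by field_simp
    rw [h6] at h5
    exact le_of_mul_le_mul_left h5 (by positivity)

theorem exists_le_measureReal_norm_sum_ge (hST : IsSatoTateSequence P ST) (A : ℝ) :
    ∃ p > 0, ∃ η > 0, ∀ (s : Finset ℤ) (z : ℤ → ℂ) (σ : ℝ), 0 < σ →
      σ ^ 2 ≤ ∑ h ∈ s, ‖z h‖ ^ 2 → (∀ h ∈ s, ‖z h‖ ≤ η * σ) →
      p ≤ P.real {ω | A * σ ≤ ‖∑ h ∈ s, z h * (ST h ω : ℂ)‖} := by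
  obtain ⟨p, hp, η, hη, H⟩ := hST.exists_le_measureReal_sum_ge (2 * |A|)
  refine ⟨p, hp, η / 2, by positivity, fun s z σ hσ hsum hsmall => ?_⟩
  have key : ∀ a : ℤ → ℝ, (∀ h, |a h| ≤ ‖z h‖) → σ ^ 2 / 2 ≤ ∑ h ∈ s, a h ^ 2 →
      (∀ ω, |∑ h ∈ s, a h * ST h ω| ≤ ‖∑ h ∈ s, z h * (ST h ω : ℂ)‖) →
      p ≤ P.real {ω | A * σ ≤ ‖∑ h ∈ s, z h * (ST h ω : ℂ)‖} := by
    intro a ha hs hle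
    set τ := Real.sqrt (∑ h ∈ s, a h ^ 2) with hτ
    have hpos : 0 < ∑ h ∈ s, a h ^ 2 := lt_of_lt_of_le (by positivity) hs
    have hτ2 : τ ^ 2 = ∑ h ∈ s, a h ^ 2 := Real.sq_sqrt hpos.le
    have hτpos : 0 < τ := Real.sqrt_pos.2 hpos
    have hστ : σ / 2 ≤ τ := by
      refine Real.le_sqrt_of_sq_le (le_trans ?_ hs)
      nlinarith [sq_nonneg σ]
    refine (H s a τ hτpos hτ2.symm fun h hh => ?_).trans (measureReal_mono fun ω hω => ?_)
    · calc |a h| ≤ ‖z h‖ := ha h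
        _ ≤ η / 2 * σ := hsmall h hh
        _ ≤ η * τ := by nlinarith
    · change A * σ ≤ _
      have h1 : 2 * |A| * τ ≤ ∑ h ∈ s, a h * ST h ω := hω
      have h2 := (le_abs_self _).trans (hle ω)
      nlinarith [le_abs_self A, abs_nonneg A]
  have hre : ∀ ω, (∑ h ∈ s, z h * (ST h ω : ℂ)).re = ∑ h ∈ s, (z h).re * ST h ω := by
    intro ω; simp
  have him : ∀ ω, (∑ h ∈ s, z h * (ST h ω : ℂ)).im = ∑ h ∈ s, (z h).im * ST h ω := by
    intro ω; simp
  have hsplit : ∑ h ∈ s, ‖z h‖ ^ 2 = ∑ h ∈ s, (z h).re ^ 2 + ∑ h ∈ s, (z h).im ^ 2 := by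
    rw [← Finset.sum_add_distrib]
    refine Finset.sum_congr rfl fun h _ => ?_
    rw [← Complex.normSq_eq_norm_sq, Complex.normSq_apply]
    ring
  rcases le_total (σ ^ 2 / 2) (∑ h ∈ s, (z h).re ^ 2) with h | h
  · exact key (fun h => (z h).re) (fun h => Complex.abs_re_le_norm _) h
      fun ω => by rw [← hre]; exact Complex.abs_re_le_norm _
  · exact key (fun h => (z h).im) (fun h => Complex.abs_im_le_norm _) (by linarith)
      fun ω => by rw [← him]; exact Complex.abs_im_le_norm _

/-- Events depending on pairwise disjoint finite sets of indices are independent. -/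
theorem measureReal_iInter_norm_sum_lt_le (hST : IsSatoTateSequence P ST) {J : Type*}
    [DecidableEq J] (s : Finset J) (T : J → Finset ℤ) (z : J → ℤ → ℂ) (θ : J → ℝ) {q : ℝ}
    (hT : ∀ i ∈ s, ∀ j ∈ s, i ≠ j → Disjoint (T i) (T j))
    (hq : ∀ j ∈ s, P.real {ω | ‖∑ h ∈ T j, z j h * (ST h ω : ℂ)‖ < θ j} ≤ q) :
    P.real {ω | ∀ j ∈ s, ‖∑ h ∈ T j, z j h * (ST h ω : ℂ)‖ < θ j} ≤ q ^ s.card := by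
  induction s using Finset.induction_on with
  | empty => simp
  | insert i s hi ih =>
    have hdisj : Disjoint (T i) (s.biUnion T) := by
      rw [Finset.disjoint_biUnion_right]
      intro j hj
      refine hT i (Finset.mem_insert_self _ _) j (Finset.mem_insert_of_mem hj) ?_
      rintro rfl
      exact hi hj
    have hind := hST.indep.indepFun_finset (T i) (s.biUnion T) hdisj hST.measurable
    let f : (T i → ℝ) → ℝ := fun x => ‖∑ h : T i, z i h * (x h : ℂ)‖
    have hf : Measurable f := by fun_prop
    let B : Set (s.biUnion T → ℝ) := ⋂ j : s,
      {x | ‖∑ h : T j, z j h * (x ⟨h, Finset.mem_biUnion.2 ⟨j, j.2, h.2⟩⟩ : ℂ)‖ < θ j}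
    have hB : MeasurableSet B := by
      refine MeasurableSet.iInter fun j => measurableSet_lt ?_ measurable_const
      fun_prop
    have h1 := hind.measure_inter_preimage_eq_mul {x | f x < θ i} B
      (measurableSet_lt hf measurable_const) hB
    have e1 : {ω | ∀ j ∈ insert i s, ‖∑ h ∈ T j, z j h * (ST h ω : ℂ)‖ < θ j} =
        {ω | ‖∑ h ∈ T i, z i h * (ST h ω : ℂ)‖ < θ i} ∩
          {ω | ∀ j ∈ s, ‖∑ h ∈ T j, z j h * (ST h ω : ℂ)‖ < θ j} := by
      ext ω
      simp
    have e2 : {ω | ‖∑ h ∈ T i, z i h * (ST h ω : ℂ)‖ < θ i} =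
        (fun ω (h : T i) => ST h ω) ⁻¹' {x | f x < θ i} := by
      ext ω
      simp only [mem_ofPred_eq, mem_preimage, f]
      rw [← Finset.sum_coe_sort (T i)]
    have e3 : {ω | ∀ j ∈ s, ‖∑ h ∈ T j, z j h * (ST h ω : ℂ)‖ < θ j} =
        (fun ω (h : s.biUnion T) => ST h ω) ⁻¹' B := by
      ext ω
      simp only [mem_ofPred_eq, mem_preimage, B, mem_iInter, Subtype.forall]
      refine forall₂_congr fun j hj => ?_
      rw [← Finset.sum_coe_sort (T j)]
    have h2 : P.real {ω | ∀ j ∈ insert i s, ‖∑ h ∈ T j, z j h * (ST h ω : ℂ)‖ < θ j} =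
        P.real {ω | ‖∑ h ∈ T i, z i h * (ST h ω : ℂ)‖ < θ i} *
          P.real {ω | ∀ j ∈ s, ‖∑ h ∈ T j, z j h * (ST h ω : ℂ)‖ < θ j} := by
      rw [e1, e2, e3]
      simp only [Measure.real]
      rw [← ENNReal.toReal_mul]
      exact congrArg ENNReal.toReal h1
    rw [h2, Finset.card_insert_of_notMem hi, pow_succ, mul_comm (q ^ _)]
    have hqi := hq i (Finset.mem_insert_self _ _)
    have hq0 : 0 ≤ q := measureReal_nonneg.trans hqi
    refine mul_le_mul hqi (ih ?_ ?_) measureReal_nonneg hq0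
    · exact fun a ha b hb => hT a (Finset.mem_insert_of_mem ha) b (Finset.mem_insert_of_mem hb)
    · exact fun j hj => hq j (Finset.mem_insert_of_mem hj)

end IsSatoTateSequence
theorem sum_Ioo_succ {E : Type*} [AddCommMonoid E] (f : ℤ → E) {m : ℕ} (hm : 1 ≤ m) :
    ∑ h ∈ Finset.Ioo (-((m + 1 : ℕ) : ℤ)) ((m + 1 : ℕ) : ℤ), f h =
      (∑ h ∈ Finset.Ioo (-(m : ℤ)) (m : ℤ), f h) + (f m + f (-m)) := by
  have h1 : Finset.Ioo (-((m + 1 : ℕ) : ℤ)) ((m + 1 : ℕ) : ℤ) =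
      insert (m : ℤ) (insert (-(m : ℤ)) (Finset.Ioo (-(m : ℤ)) (m : ℤ))) := by
    ext h
    simp only [Finset.mem_Ioo, Finset.mem_insert]
    omega
  rw [h1, Finset.sum_insert, Finset.sum_insert]
  · abel
  · simp
  · simp only [Finset.mem_insert, Finset.mem_Ioo]
    omega

theorem sum_Ioo_one {E : Type*} [AddCommMonoid E] (f : ℤ → E) :
    ∑ h ∈ Finset.Ioo (-((1 : ℕ) : ℤ)) ((1 : ℕ) : ℤ), f h = f 0 := by
  have h1 : Finset.Ioo (-((1 : ℕ) : ℤ)) ((1 : ℕ) : ℤ) = {0} := by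
    ext h
    simp only [Finset.mem_Ioo, Finset.mem_singleton]
    omega
  rw [h1, Finset.sum_singleton]

/-- The character `x ↦ e^{2πix}`. -/
noncomputable def expi (x : ℝ) : ℂ := Complex.exp (2 * Real.pi * Complex.I * x)

theorem expi_eq (x : ℝ) : expi x = Complex.exp ((2 * Real.pi * x : ℝ) * Complex.I) := by
  rw [expi]
  congr 1
  push_cast
  ring

theorem norm_expi (x : ℝ) : ‖expi x‖ = 1 := by
  rw [expi_eq, Complex.norm_exp_ofReal_mul_I]

theorem expi_add (x y : ℝ) : expi (x + y) = expi x * expi y := by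
  rw [expi, expi, expi, ← Complex.exp_add]
  congr 1
  push_cast
  ring

theorem expi_zero : expi 0 = 1 := by simp [expi]

theorem expi_int (n : ℤ) : expi n = 1 := by
  rw [expi, ← Complex.exp_int_mul_two_pi_mul_I n]
  congr 1
  push_cast
  ring

theorem re_expi (x : ℝ) : (expi x).re = Real.cos (2 * Real.pi * x) := by
  rw [expi_eq, Complex.exp_ofReal_mul_I_re]

theorem im_expi (x : ℝ) : (expi x).im = Real.sin (2 * Real.pi * x) := by
  rw [expi_eq, Complex.exp_ofReal_mul_I_im]

theorem continuous_expi : Continuous expi := by unfold expi; fun_prop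

theorem hasDerivAt_expi (x : ℝ) : HasDerivAt expi (2 * Real.pi * Complex.I * expi x) x := by
  have h : HasDerivAt (fun y : ℝ => (2 * Real.pi * Complex.I * y : ℂ))
      (2 * Real.pi * Complex.I * 1) x := (Complex.ofRealCLM.hasDerivAt).const_mul _
  have := h.cexp
  unfold expi
  convert this using 1
  ring

theorem norm_expi_sub_le (x y : ℝ) : ‖expi x - expi y‖ ≤ 2 * Real.pi * |x - y| := by
  have := Convex.norm_image_sub_le_of_norm_hasDerivWithin_le (f := expi)
    (f' := fun x => 2 * Real.pi * Complex.I * expi x) (C := 2 * Real.pi) (s := univ) (x := y)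
    (y := x) (fun x _ => (hasDerivAt_expi x).hasDerivWithinAt) ?_ convex_univ trivial trivial
  · simpa using this
  · intro x _
    simp [norm_expi, abs_of_pos Real.pi_pos]

theorem coeff_of_ne_zero {h : ℤ} (hh : h ≠ 0) (t : ℝ) :
    coeff h t = (expi (h * t) - 1) / (2 * Real.pi * Complex.I * h) := by
  rw [coeff, if_neg hh, expi]
  push_cast
  ring_nf

theorem norm_coeff_le {h : ℤ} (hh : h ≠ 0) (t : ℝ) : ‖coeff h t‖ ≤ 1 / (3 * |(h : ℝ)|) := by
  have hpos : 0 < |(h : ℝ)| := abs_pos.2 (by exact_mod_cast hh)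
  have h2 : ‖expi (h * t) - 1‖ ≤ 2 := by
    refine (norm_sub_le _ _).trans ?_
    rw [norm_expi, norm_one]
    norm_num
  rw [coeff_of_ne_zero hh, norm_div]
  have h3 : ‖(2 * Real.pi * Complex.I * h : ℂ)‖ = 2 * Real.pi * |(h : ℝ)| := by
    simp [abs_of_pos Real.pi_pos]
  rw [h3, div_le_div_iff₀ (by positivity) (by positivity)]
  nlinarith [Real.pi_gt_three]

theorem norm_coeff_zero (t : ℝ) : ‖coeff 0 t‖ = |t| := by simp [coeff]

theorem sum_norm_coeff_le {t : ℝ} (ht : |t| ≤ 1) {m : ℕ} (hm : 1 ≤ m) :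
    ∑ h ∈ Finset.Ioo (-(m : ℤ)) (m : ℤ), ‖coeff h t‖ ≤ 1 + 4 / 3 * Real.log m := by
  induction m, hm using Nat.le_induction with
  | base =>
    rw [sum_Ioo_one, norm_coeff_zero]
    simpa using ht
  | succ m hm ih =>
    rw [sum_Ioo_succ _ hm]
    have hm' : (1 : ℝ) ≤ m := by exact_mod_cast hm
    have hne : (m : ℤ) ≠ 0 := by omega
    have h1 := norm_coeff_le hne t
    have h2 := norm_coeff_le (neg_ne_zero.2 hne) t
    have h3 : 1 - (((m + 1 : ℕ) : ℝ) / m)⁻¹ ≤ Real.log (((m + 1 : ℕ) : ℝ) / m) :=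
      Real.one_sub_inv_le_log_of_pos (by positivity)
    rw [Real.log_div (by positivity) (by positivity)] at h3
    have e : 1 - (((m + 1 : ℕ) : ℝ) / m)⁻¹ = 1 / (m + 1) := by push_cast; field_simp; ring
    have h4 : 1 / (3 * (m : ℝ)) ≤ 2 / 3 * (1 / (m + 1)) := by
      rw [div_mul_div_comm, div_le_div_iff₀ (by positivity) (by positivity)]
      nlinarith
    simp only [Int.cast_neg, Int.cast_natCast, abs_neg, abs_of_nonneg (by positivity : (0 : ℝ) ≤ m)]
      at h1 h2
    rw [e] at h3
    linarith

theorem sum_norm_coeff_sq_sdiff_le (t : ℝ) {m M : ℕ} (hm : 1 ≤ m) (hM : m ≤ M) :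
    ∑ h ∈ Finset.Ioo (-(M : ℤ)) (M : ℤ) \ Finset.Ioo (-(m : ℤ)) (m : ℤ), ‖coeff h t‖ ^ 2 ≤
      1 / m := by
  have key : ∑ h ∈ Finset.Ioo (-(M : ℤ)) (M : ℤ), ‖coeff h t‖ ^ 2 ≤
      ∑ h ∈ Finset.Ioo (-(m : ℤ)) (m : ℤ), ‖coeff h t‖ ^ 2 + (1 / m - 1 / M) := by
    induction M, hM using Nat.le_induction with
    | base => simp
    | succ M hM ih =>
      have hM1 : 1 ≤ M := hm.trans hM
      have hM' : (1 : ℝ) ≤ M := by exact_mod_cast hM1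
      have hne : (M : ℤ) ≠ 0 := by omega
      rw [sum_Ioo_succ _ hM1]
      have h1 := pow_le_pow_left₀ (norm_nonneg _) (norm_coeff_le hne t) 2
      have h2 := pow_le_pow_left₀ (norm_nonneg _) (norm_coeff_le (neg_ne_zero.2 hne) t) 2
      simp only [Int.cast_neg, Int.cast_natCast, abs_neg,
        abs_of_nonneg (by positivity : (0 : ℝ) ≤ M)] at h1 h2
      have h3 : 2 * (1 / (3 * (M : ℝ))) ^ 2 ≤ 1 / M - 1 / ((M + 1 : ℕ) : ℝ) := by
        push_cast
        rw [div_sub_div _ _ (by positivity) (by positivity), div_pow, mul_div_assoc',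
          div_le_div_iff₀ (by positivity) (by positivity)]
        nlinarith [mul_nonneg (by positivity : (0 : ℝ) ≤ M) (by linarith : (0 : ℝ) ≤ M - 1)]
      linarith
  have hsub : Finset.Ioo (-(m : ℤ)) (m : ℤ) ⊆ Finset.Ioo (-(M : ℤ)) (M : ℤ) := by
    intro h
    simp only [Finset.mem_Ioo]
    omega
  have := Finset.sum_sdiff hsub (f := fun h => ‖coeff h t‖ ^ 2)
  have hMpos : 0 ≤ 1 / (M : ℝ) := by positivity
  linarith

theorem partialSum_sub_partialSum {Ω : Type*} (ST : ℤ → Ω → ℝ) {m M : ℕ} (hM : m ≤ M) (t : ℝ)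
    (ω : Ω) : partialSum ST M t ω - partialSum ST m t ω =
      ∑ h ∈ Finset.Ioo (-(M : ℤ)) (M : ℤ) \ Finset.Ioo (-(m : ℤ)) (m : ℤ),
        coeff h t * (ST h ω : ℂ) := by
  have hsub : Finset.Ioo (-(m : ℤ)) (m : ℤ) ⊆ Finset.Ioo (-(M : ℤ)) (M : ℤ) := by
    intro h
    simp only [Finset.mem_Ioo]
    omega
  rw [partialSum, partialSum, ← Finset.sum_sdiff hsub]
  ring

theorem re_im_sum {Ω : Type*} {ST : ℤ → Ω → ℝ} (s : Finset ℤ) (z : ℤ → ℂ) (l ν : ℝ) (ω : Ω) :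
    l * (∑ h ∈ s, z h * (ST h ω : ℂ)).re + ν * (∑ h ∈ s, z h * (ST h ω : ℂ)).im =
      ∑ h ∈ s, (l * (z h).re + ν * (z h).im) * ST h ω := by
  simp only [Complex.re_sum, Complex.im_sum, Finset.mul_sum, ← Finset.sum_add_distrib]
  refine Finset.sum_congr rfl fun h _ => ?_
  simp
  ring

namespace IsSatoTateSequence

variable {Ω : Type*} [MeasurableSpace Ω] {P : Measure Ω} {ST : ℤ → Ω → ℝ}

theorem measurable_sum (hST : IsSatoTateSequence P ST) (s : Finset ℤ) (z : ℤ → ℂ) :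
    Measurable fun ω => ∑ h ∈ s, z h * (ST h ω : ℂ) :=
  Finset.measurable_sum _ fun h _ =>
    (Complex.measurable_ofReal.comp (hST.measurable h)).const_mul _

theorem measurable_partialSum (hST : IsSatoTateSequence P ST) (m : ℕ) (t : ℝ) :
    Measurable (partialSum ST m t) := hST.measurable_sum _ _

theorem eLpNorm_partialSum_top_le (hST : IsSatoTateSequence P ST) {t : ℝ} (ht : |t| ≤ 1) {m : ℕ}
    (hm : 2 ≤ m) : eLpNorm (partialSum ST m t) ∞ P ≤ ENNReal.ofReal (8 * Real.log m) := by
  rw [eLpNorm_exponent_top]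
  refine eLpNormEssSup_le_of_ae_bound ?_
  filter_upwards [hST.ae_abs_le] with ω hω
  have hlog : 1 / 2 ≤ Real.log m := by
    have h1 : Real.log 2 ≤ Real.log m := Real.log_le_log (by norm_num) (by exact_mod_cast hm)
    have := Real.log_two_gt_d9
    linarith
  have h2 := sum_norm_coeff_le ht (by omega : 1 ≤ m)
  calc ‖partialSum ST m t ω‖
      ≤ ∑ h ∈ Finset.Ioo (-(m : ℤ)) (m : ℤ), ‖coeff h t * (ST h ω : ℂ)‖ := norm_sum_le _ _
    _ ≤ ∑ h ∈ Finset.Ioo (-(m : ℤ)) (m : ℤ), ‖coeff h t‖ * 2 := by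
        refine Finset.sum_le_sum fun h _ => ?_
        rw [norm_mul, Complex.norm_real]
        exact mul_le_mul_of_nonneg_left (hω h) (norm_nonneg _)
    _ ≤ 8 * Real.log m := by
        rw [← Finset.sum_mul]
        linarith

variable [IsProbabilityMeasure P]

theorem integrable_exp_re_im (hST : IsSatoTateSequence P ST) (s : Finset ℤ) (z : ℤ → ℂ)
    (l ν : ℝ) : Integrable (fun ω => Real.exp (l * (∑ h ∈ s, z h * (ST h ω : ℂ)).re +
      ν * (∑ h ∈ s, z h * (ST h ω : ℂ)).im)) P := by
  simp_rw [re_im_sum]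
  exact hST.integrable_exp_sum _ _

theorem integral_exp_re_im_le (hST : IsSatoTateSequence P ST) (s : Finset ℤ) (z : ℤ → ℂ)
    (l ν : ℝ) : ∫ ω, Real.exp (l * (∑ h ∈ s, z h * (ST h ω : ℂ)).re +
      ν * (∑ h ∈ s, z h * (ST h ω : ℂ)).im) ∂P ≤
      Real.exp (2 * (l ^ 2 + ν ^ 2) * ∑ h ∈ s, ‖z h‖ ^ 2) := by
  simp_rw [re_im_sum]
  refine (hST.integral_exp_sum_le _ _).trans (Real.exp_le_exp.2 ?_)
  rw [mul_assoc, Finset.mul_sum (a := l ^ 2 + ν ^ 2)]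
  gcongr with h hh
  rw [← Complex.normSq_eq_norm_sq, Complex.normSq_apply]
  nlinarith [sq_nonneg (l * (z h).im - ν * (z h).re)]

/-- The constant in the bound for the `n`-th moment of a linear combination. -/
noncomputable def momentConst (n : ℕ) : ℝ := n.factorial * (4 * Real.exp 4)

theorem norm_pow_le {x : ℂ} {σ : ℝ} (hσ : 0 < σ) (n : ℕ) :
    ‖x‖ ^ n ≤ σ ^ n * n.factorial *
      ((Real.exp (1 / σ * x.re + 1 / σ * x.im) + Real.exp (1 / σ * x.re + -(1 / σ) * x.im)) +
      (Real.exp (-(1 / σ) * x.re + 1 / σ * x.im) +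
        Real.exp (-(1 / σ) * x.re + -(1 / σ) * x.im))) := by
  have h1 := Real.pow_div_factorial_le_exp (‖x‖ / σ) (by positivity) n
  have h2 : Real.exp (‖x‖ / σ) ≤ Real.exp (|x.re| / σ) * Real.exp (|x.im| / σ) := by
    rw [← Real.exp_add, ← add_div]
    refine Real.exp_le_exp.2 ?_
    gcongr
    exact Complex.norm_le_abs_re_add_abs_im x
  have h3 (y : ℝ) : Real.exp (|y| / σ) ≤ Real.exp (1 / σ * y) + Real.exp (-(1 / σ) * y) := by
    rcases abs_cases y with ⟨h, _⟩ | ⟨h, _⟩ <;> rw [h]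
    · have : y / σ = 1 / σ * y := by ring
      rw [this]
      linarith [Real.exp_pos (-(1 / σ) * y)]
    · have : -y / σ = -(1 / σ) * y := by ring
      rw [this]
      linarith [Real.exp_pos (1 / σ * y)]
  have h4 : Real.exp (‖x‖ / σ) ≤ (Real.exp (1 / σ * x.re) + Real.exp (-(1 / σ) * x.re)) *
      (Real.exp (1 / σ * x.im) + Real.exp (-(1 / σ) * x.im)) :=
    h2.trans (mul_le_mul (h3 _) (h3 _) (Real.exp_pos _).le (by positivity))
  have h5 := h1.trans h4
  rw [div_pow, div_div, div_le_iff₀ (by positivity)] at h5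
  refine h5.trans (le_of_eq ?_)
  simp only [Real.exp_add]
  ring

theorem integrable_norm_pow (hST : IsSatoTateSequence P ST) (s : Finset ℤ) (z : ℤ → ℂ) (n : ℕ) :
    Integrable (fun ω => ‖∑ h ∈ s, z h * (ST h ω : ℂ)‖ ^ n) P := by
  refine Integrable.mono' ((((hST.integrable_exp_re_im s z (1 / 1) (1 / 1)).add
    (hST.integrable_exp_re_im s z (1 / 1) (-(1 / 1)))).add
    ((hST.integrable_exp_re_im s z (-(1 / 1)) (1 / 1)).add
    (hST.integrable_exp_re_im s z (-(1 / 1)) (-(1 / 1))))).const_mul (1 ^ n * n.factorial))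
    ((hST.measurable_sum s z).norm.pow_const n).aestronglyMeasurable
    (ae_of_all _ fun ω => ?_)
  rw [Real.norm_of_nonneg (by positivity)]
  exact norm_pow_le one_pos n

theorem integral_norm_pow_le (hST : IsSatoTateSequence P ST) (s : Finset ℤ) (z : ℤ → ℂ) (n : ℕ)
    {σ : ℝ} (hσ : 0 < σ) (hz : ∑ h ∈ s, ‖z h‖ ^ 2 ≤ σ ^ 2) :
    ∫ ω, ‖∑ h ∈ s, z h * (ST h ω : ℂ)‖ ^ n ∂P ≤ momentConst n * σ ^ n := by
  have hi := hST.integrable_exp_re_im s z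
  have hle (l ν : ℝ) (hl : l ^ 2 = (1 / σ) ^ 2) (hν : ν ^ 2 = (1 / σ) ^ 2) :
      ∫ ω, Real.exp (l * (∑ h ∈ s, z h * (ST h ω : ℂ)).re +
        ν * (∑ h ∈ s, z h * (ST h ω : ℂ)).im) ∂P ≤ Real.exp 4 := by
    refine (hST.integral_exp_re_im_le s z l ν).trans (Real.exp_le_exp.2 ?_)
    rw [hl, hν]
    calc 2 * ((1 / σ) ^ 2 + (1 / σ) ^ 2) * ∑ h ∈ s, ‖z h‖ ^ 2
        ≤ 2 * ((1 / σ) ^ 2 + (1 / σ) ^ 2) * σ ^ 2 := by gcongr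
      _ = 4 := by field_simp; norm_num
  have e1 := (hi (1 / σ) (1 / σ)).add (hi (1 / σ) (-(1 / σ)))
  have e2 := (hi (-(1 / σ)) (1 / σ)).add (hi (-(1 / σ)) (-(1 / σ)))
  have h1 := integral_mono (hST.integrable_norm_pow s z n)
    ((e1.add e2).const_mul (σ ^ n * n.factorial)) fun ω => norm_pow_le hσ n
  refine h1.trans ?_
  rw [integral_const_mul, integral_add' e1 e2, integral_add' (hi _ _) (hi _ _),
    integral_add' (hi _ _) (hi _ _)]
  have a1 := hle (1 / σ) (1 / σ) rfl rfl
  have a2 := hle (1 / σ) (-(1 / σ)) rfl (neg_sq _)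
  have a3 := hle (-(1 / σ)) (1 / σ) (neg_sq _) rfl
  have a4 := hle (-(1 / σ)) (-(1 / σ)) (neg_sq _) (neg_sq _)
  have : momentConst n * σ ^ n = σ ^ n * n.factorial * (4 * Real.exp 4) := by
    rw [momentConst]; ring
  rw [this]
  refine mul_le_mul_of_nonneg_left ?_ (by positivity)
  linarith

theorem eLpNorm_sum_le (hST : IsSatoTateSequence P ST) (s : Finset ℤ) (z : ℤ → ℂ) {n : ℕ}
    (hn : 1 ≤ n) {σ : ℝ} (hσ : 0 < σ) (hz : ∑ h ∈ s, ‖z h‖ ^ 2 ≤ σ ^ 2) :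
    eLpNorm (fun ω => ∑ h ∈ s, z h * (ST h ω : ℂ)) n P ≤
      ENNReal.ofReal (momentConst n ^ ((n : ℝ)⁻¹) * σ) := by
  have hn0 : (n : ℝ≥0∞) ≠ 0 := by exact_mod_cast (by omega : n ≠ 0)
  have hmem : MemLp (fun ω => ∑ h ∈ s, z h * (ST h ω : ℂ)) n P := by
    refine (integrable_norm_rpow_iff (hST.measurable_sum s z).aestronglyMeasurable hn0
      (by simp)).1 ?_
    simpa using hST.integrable_norm_pow s z n
  rw [hmem.eLpNorm_eq_integral_rpow_norm hn0 (by simp)]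
  refine ENNReal.ofReal_le_ofReal ?_
  simp only [ENNReal.toReal_natCast, Real.rpow_natCast]
  have hM : 0 ≤ momentConst n := by unfold momentConst; positivity
  calc (∫ ω, ‖∑ h ∈ s, z h * (ST h ω : ℂ)‖ ^ n ∂P) ^ ((n : ℝ)⁻¹)
      ≤ (momentConst n * σ ^ n) ^ ((n : ℝ)⁻¹) :=
        Real.rpow_le_rpow (integral_nonneg fun ω => by positivity)
          (hST.integral_norm_pow_le s z n hσ hz) (by positivity)
    _ = momentConst n ^ ((n : ℝ)⁻¹) * σ := by
        rw [Real.mul_rpow hM (by positivity), Real.pow_rpow_inv_natCast hσ.le (by omega)]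

end IsSatoTateSequence
end KloostermanPaths

namespace KloostermanPaths
namespace IsSatoTateSequence

variable {Ω : Type*} [MeasurableSpace Ω] {P : Measure Ω} {ST : ℤ → Ω → ℝ}

theorem aestronglyMeasurable_K (hST : IsSatoTateSequence P ST) {t : ℝ}
    (hK : ∀ᵐ ω ∂P, Tendsto (fun m => partialSum ST m t ω) atTop (𝓝 (K ST t ω))) :
    AEStronglyMeasurable (K ST t) P :=
  aestronglyMeasurable_of_tendsto_ae atTop
    (fun m => (hST.measurable_partialSum m t).aestronglyMeasurable) hK

variable [IsProbabilityMeasure P]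

theorem eLpNorm_sub_K_le (hST : IsSatoTateSequence P ST) {t : ℝ}
    (hK : ∀ᵐ ω ∂P, Tendsto (fun m => partialSum ST m t ω) atTop (𝓝 (K ST t ω)))
    {n : ℕ} (hn : 1 ≤ n) {m : ℕ} (hm : 1 ≤ m) :
    eLpNorm (partialSum ST m t - K ST t) n P ≤
      ENNReal.ofReal (momentConst n ^ ((n : ℝ)⁻¹) * Real.sqrt (1 / m)) := by
  have hmpos : (0 : ℝ) < 1 / m := by
    have : (0 : ℝ) < m := by exact_mod_cast hm
    positivity
  have h1 : eLpNorm (K ST t - partialSum ST m t) n P ≤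
      atTop.liminf fun M => eLpNorm (partialSum ST M t - partialSum ST m t) n P := by
    refine Lp.eLpNorm_lim_le_liminf_eLpNorm
      (fun M => ((hST.measurable_partialSum M t).sub
        (hST.measurable_partialSum m t)).aestronglyMeasurable) _ ?_
    filter_upwards [hK] with ω hω
    exact hω.sub_const _
  rw [eLpNorm_sub_comm]
  refine h1.trans (liminf_le_of_le (by isBoundedDefault) fun b hb => ?_)
  obtain ⟨M, hM1, hM2⟩ := (hb.and (eventually_ge_atTop m)).exists
  refine hM1.trans ?_
  have e : partialSum ST M t - partialSum ST m t = fun ω =>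
      ∑ h ∈ Finset.Ioo (-(M : ℤ)) (M : ℤ) \ Finset.Ioo (-(m : ℤ)) (m : ℤ),
        coeff h t * (ST h ω : ℂ) := by
    ext ω
    exact partialSum_sub_partialSum ST hM2 t ω
  rw [e]
  refine hST.eLpNorm_sum_le _ _ hn (Real.sqrt_pos.2 hmpos) ?_
  rw [Real.sq_sqrt hmpos.le]
  exact sum_norm_coeff_sq_sdiff_le t hm hM2

theorem memLp_partialSum (hST : IsSatoTateSequence P ST) (m : ℕ) (t : ℝ) (q : ℝ≥0∞) :
    MemLp (partialSum ST m t) q P := by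
  refine MemLp.of_bound (hST.measurable_partialSum m t).aestronglyMeasurable
    (∑ h ∈ Finset.Ioo (-(m : ℤ)) (m : ℤ), ‖coeff h t‖ * 2) ?_
  filter_upwards [hST.ae_abs_le] with ω hω
  refine (norm_sum_le _ _).trans (Finset.sum_le_sum fun h _ => ?_)
  rw [norm_mul, Complex.norm_real]
  exact mul_le_mul_of_nonneg_left (hω h) (norm_nonneg _)

theorem tendsto_eLpNorm_natCast (hST : IsSatoTateSequence P ST) {t : ℝ}
    (hK : ∀ᵐ ω ∂P, Tendsto (fun m => partialSum ST m t ω) atTop (𝓝 (K ST t ω)))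
    {n : ℕ} (hn : 1 ≤ n) :
    Tendsto (fun m => eLpNorm (partialSum ST m t - K ST t) n P) atTop (𝓝 0) := by
  have h1 : Tendsto (fun m : ℕ => ENNReal.ofReal
      (momentConst n ^ ((n : ℝ)⁻¹) * Real.sqrt (1 / m))) atTop (𝓝 0) := by
    rw [← ENNReal.ofReal_zero]
    refine ENNReal.tendsto_ofReal ?_
    have h2 : Tendsto (fun m : ℕ => Real.sqrt (1 / m)) atTop (𝓝 (Real.sqrt 0)) :=
      (Real.continuous_sqrt.tendsto 0).comp tendsto_one_div_atTop_nhds_zero_nat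
    simpa using h2.const_mul (momentConst n ^ ((n : ℝ)⁻¹))
  refine tendsto_of_tendsto_of_tendsto_of_le_of_le' tendsto_const_nhds h1
    (Eventually.of_forall fun _ => zero_le) ?_
  filter_upwards [eventually_ge_atTop 1] with m hm
  exact hST.eLpNorm_sub_K_le hK hn hm

theorem exists_natCast_ge {q : ℝ≥0∞} (hq : q ≠ ∞) : ∃ n : ℕ, 1 ≤ n ∧ q ≤ n := by
  obtain ⟨n, hn⟩ := ENNReal.exists_nat_gt hq
  refine ⟨n + 1, by omega, hn.le.trans ?_⟩
  exact_mod_cast Nat.le_succ n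

theorem tendsto_eLpNorm (hST : IsSatoTateSequence P ST) {t : ℝ}
    (hK : ∀ᵐ ω ∂P, Tendsto (fun m => partialSum ST m t ω) atTop (𝓝 (K ST t ω)))
    {q : ℝ≥0∞} (hq : q ≠ ∞) :
    Tendsto (fun m => eLpNorm (partialSum ST m t - K ST t) q P) atTop (𝓝 0) := by
  obtain ⟨n, hn, hqn⟩ := exists_natCast_ge hq
  refine tendsto_of_tendsto_of_tendsto_of_le_of_le tendsto_const_nhds
    (hST.tendsto_eLpNorm_natCast hK hn) (fun _ => zero_le) fun m => ?_
  exact eLpNorm_le_eLpNorm_of_exponent_le hqn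
    ((hST.measurable_partialSum m t).aestronglyMeasurable.sub (hST.aestronglyMeasurable_K hK))

theorem memLp_K (hST : IsSatoTateSequence P ST) {t : ℝ}
    (hK : ∀ᵐ ω ∂P, Tendsto (fun m => partialSum ST m t ω) atTop (𝓝 (K ST t ω)))
    {q : ℝ≥0∞} (hq : q ≠ ∞) : MemLp (K ST t) q P := by
  obtain ⟨n, hn, hqn⟩ := exists_natCast_ge hq
  refine MemLp.mono_exponent ?_ hqn
  have h1 : MemLp (partialSum ST 1 t - K ST t) n P :=
    ⟨(hST.measurable_partialSum 1 t).aestronglyMeasurable.sub (hST.aestronglyMeasurable_K hK),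
      (hST.eLpNorm_sub_K_le hK hn le_rfl).trans_lt ENNReal.ofReal_lt_top⟩
  have := (hST.memLp_partialSum 1 t n).sub h1
  simpa using this

theorem tendstoInDistribution (hST : IsSatoTateSequence P ST) {t : ℝ}
    (hK : ∀ᵐ ω ∂P, Tendsto (fun m => partialSum ST m t ω) atTop (𝓝 (K ST t ω))) :
    TendstoInDistribution (fun m => partialSum ST m t) atTop (K ST t) (fun _ => P) P :=
  (tendstoInMeasure_of_tendsto_ae
    (fun m => (hST.measurable_partialSum m t).aestronglyMeasurable) hK).tendstoInDistribution
    fun m => (hST.measurable_partialSum m t).aemeasurable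

theorem integrable_norm_K_sub (hST : IsSatoTateSequence P ST) {t : ℝ}
    (hK : ∀ᵐ ω ∂P, Tendsto (fun m => partialSum ST m t ω) atTop (𝓝 (K ST t ω))) (m : ℕ) :
    Integrable (fun ω => ‖K ST t ω - partialSum ST m t ω‖) P :=
  ((memLp_one_iff_integrable.1 (hST.memLp_K hK ENNReal.one_ne_top)).sub
    (memLp_one_iff_integrable.1 (hST.memLp_partialSum m t 1))).norm

theorem integral_norm_K_sub_le (hST : IsSatoTateSequence P ST) {t : ℝ}
    (hK : ∀ᵐ ω ∂P, Tendsto (fun m => partialSum ST m t ω) atTop (𝓝 (K ST t ω))) {m : ℕ}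
    (hm : 1 ≤ m) : ∫ ω, ‖K ST t ω - partialSum ST m t ω‖ ∂P ≤
      momentConst 1 * (m : ℝ) ^ (-(1 / 2) : ℝ) := by
  have h1 := hST.eLpNorm_sub_K_le hK le_rfl hm
  rw [eLpNorm_sub_comm, Nat.cast_one, eLpNorm_one_eq_lintegral_enorm] at h1
  have h2 := hST.integrable_norm_K_sub hK m
  have hM : 0 ≤ momentConst 1 := by unfold momentConst; positivity
  change ∫ ω, ‖(K ST t - partialSum ST m t) ω‖ ∂P ≤ _
  rw [integral_norm_eq_lintegral_enorm
    ((hST.aestronglyMeasurable_K hK).sub (hST.measurable_partialSum m t).aestronglyMeasurable)]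
  refine ENNReal.toReal_le_of_le_ofReal (by positivity) (h1.trans (ENNReal.ofReal_le_ofReal ?_))
  rw [Real.rpow_neg (by positivity), ← Real.sqrt_eq_rpow, one_div, Real.sqrt_inv]
  simp

theorem integrable_norm_K_pow (hST : IsSatoTateSequence P ST) {t : ℝ}
    (hK : ∀ᵐ ω ∂P, Tendsto (fun m => partialSum ST m t ω) atTop (𝓝 (K ST t ω))) (k : ℕ) :
    Integrable (fun ω => ‖K ST t ω‖ ^ k) P :=
  (hST.memLp_K hK (ENNReal.natCast_ne_top k)).integrable_norm_pow'

theorem integrable_exp_K (hST : IsSatoTateSequence P ST) {t : ℝ}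
    (hK : ∀ᵐ ω ∂P, Tendsto (fun m => partialSum ST m t ω) atTop (𝓝 (K ST t ω))) (l ν : ℝ) :
    Integrable (fun ω => Real.exp (l * (K ST t ω).re + ν * (K ST t ω).im)) P := by
  have hKm := (hST.aestronglyMeasurable_K hK).aemeasurable
  have hmeas : AEMeasurable (fun ω => Real.exp (l * (K ST t ω).re + ν * (K ST t ω).im)) P := by
    fun_prop
  refine ⟨hmeas.aestronglyMeasurable, ?_⟩
  set B := Real.exp (2 * (l ^ 2 + ν ^ 2) * (‖coeff 0 t‖ ^ 2 + 1)) with hB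
  have hbound (m : ℕ) (hm : 1 ≤ m) : ∫⁻ ω, ENNReal.ofReal
      (Real.exp (l * (partialSum ST m t ω).re + ν * (partialSum ST m t ω).im)) ∂P ≤
      ENNReal.ofReal B := by
    simp only [partialSum]
    rw [← ofReal_integral_eq_lintegral_ofReal (hST.integrable_exp_re_im _ _ l ν)
      (ae_of_all _ fun ω => (Real.exp_pos _).le)]
    refine ENNReal.ofReal_le_ofReal ((hST.integral_exp_re_im_le _ _ l ν).trans ?_)
    rw [hB]
    gcongr
    have h1 := sum_norm_coeff_sq_sdiff_le t (le_refl 1) hm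
    have hsub : Finset.Ioo (-((1 : ℕ) : ℤ)) ((1 : ℕ) : ℤ) ⊆ Finset.Ioo (-(m : ℤ)) (m : ℤ) := by
      intro h
      simp only [Finset.mem_Ioo]
      omega
    rw [← Finset.sum_sdiff hsub, sum_Ioo_one]
    simp only [Nat.cast_one, div_one] at h1 ⊢
    linarith
  have hlim : ∀ᵐ ω ∂P, ‖Real.exp (l * (K ST t ω).re + ν * (K ST t ω).im)‖ₑ ≤
      atTop.liminf fun m : ℕ => ENNReal.ofReal
        (Real.exp (l * (partialSum ST m t ω).re + ν * (partialSum ST m t ω).im)) := by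
    filter_upwards [hK] with ω hω
    have hc : Continuous fun x : ℂ => ENNReal.ofReal (Real.exp (l * x.re + ν * x.im)) :=
      ENNReal.continuous_ofReal.comp (by fun_prop)
    have h2 := (hc.tendsto _).comp hω
    rw [Real.enorm_of_nonneg (Real.exp_pos _).le]
    exact h2.liminf_eq.ge
  rw [hasFiniteIntegral_iff_enorm]
  calc _ ≤ _ := lintegral_mono_ae hlim
    _ ≤ _ := lintegral_liminf_le fun m => by
        have := hST.measurable_partialSum m t
        fun_prop
    _ ≤ ENNReal.ofReal B := by
        refine liminf_le_of_le (by isBoundedDefault) fun b hb => ?_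
        obtain ⟨m, h1, h2⟩ := (hb.and (eventually_ge_atTop 1)).exists
        exact h1.trans (hbound m h2)
    _ < ∞ := ENNReal.ofReal_lt_top

end IsSatoTateSequence
/-- The trigonometric sum `∑_{|h| < m} x_h e^{2πiht}`. -/
noncomputable def trigSum (x : ℤ → ℝ) (m : ℕ) (t : ℝ) : ℂ :=
  ∑ h ∈ Finset.Ioo (-(m : ℤ)) (m : ℤ), (x h : ℂ) * expi (h * t)

theorem card_Ioo_le (m : ℕ) : ((Finset.Ioo (-(m : ℤ)) (m : ℤ)).card : ℝ) ≤ 2 * m := by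
  have : (Finset.Ioo (-(m : ℤ)) (m : ℤ)).card ≤ 2 * m := by
    rw [Int.card_Ioo]
    omega
  exact_mod_cast this

theorem norm_trigSum_le {x : ℤ → ℝ} (hx : ∀ h, |x h| ≤ 2) (m : ℕ) (t : ℝ) :
    ‖trigSum x m t‖ ≤ 4 * m := by
  calc ‖trigSum x m t‖ ≤ ∑ h ∈ Finset.Ioo (-(m : ℤ)) (m : ℤ), (2 : ℝ) := by
        refine (norm_sum_le _ _).trans (Finset.sum_le_sum fun h _ => ?_)
        rw [norm_mul, norm_expi, mul_one, Complex.norm_real]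
        exact hx h
    _ ≤ 4 * m := by
        rw [Finset.sum_const, nsmul_eq_mul]
        linarith [card_Ioo_le m]

theorem norm_trigSum_sub_le {x : ℤ → ℝ} (hx : ∀ h, |x h| ≤ 2) (m : ℕ) (s t : ℝ) :
    ‖trigSum x m s - trigSum x m t‖ ≤ 8 * Real.pi * m ^ 2 * |s - t| := by
  calc ‖trigSum x m s - trigSum x m t‖
      ≤ ∑ h ∈ Finset.Ioo (-(m : ℤ)) (m : ℤ), (2 * (2 * Real.pi * (m * |s - t|))) := by
        rw [trigSum, trigSum, ← Finset.sum_sub_distrib]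
        refine (norm_sum_le _ _).trans (Finset.sum_le_sum fun h hh => ?_)
        rw [← mul_sub, norm_mul, Complex.norm_real]
        refine mul_le_mul (hx h) ((norm_expi_sub_le _ _).trans ?_) (norm_nonneg _) (by norm_num)
        rw [← mul_sub, abs_mul]
        have : |(h : ℝ)| ≤ m := by
          rw [Finset.mem_Ioo] at hh
          rw [abs_le]
          constructor
          · exact_mod_cast hh.1.le
          · exact_mod_cast hh.2.le
        gcongr
    _ ≤ 8 * Real.pi * m ^ 2 * |s - t| := by
        rw [Finset.sum_const, nsmul_eq_mul]
        have := card_Ioo_le m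
        calc _ ≤ (2 * m) * (2 * (2 * Real.pi * (m * |s - t|))) := by
              refine mul_le_mul_of_nonneg_right this ?_
              have := Real.pi_pos
              positivity
          _ = _ := by ring

theorem trigSum_add_int (x : ℤ → ℝ) (m : ℕ) (t : ℝ) (n : ℤ) :
    trigSum x m (t + n) = trigSum x m t := by
  refine Finset.sum_congr rfl fun h _ => ?_
  rw [mul_add, expi_add, ← Int.cast_mul, expi_int, mul_one]

namespace IsSatoTateSequence

variable {Ω : Type*} [MeasurableSpace Ω] {P : Measure Ω} [IsProbabilityMeasure P] {ST : ℤ → Ω → ℝ}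

theorem measureReal_norm_trigSum_ge_le (hST : IsSatoTateSequence P ST) {a : ℤ → ℝ}
    (ha : ∀ h, |a h| ≤ 1) {m : ℕ} (hm : 1 ≤ m) (t : ℝ) :
    P.real {ω | 16 * Real.sqrt (m * Real.log m) ≤ ‖trigSum (fun h => a h * ST h ω) m t‖} ≤
      4 * ((m : ℝ) ^ 4)⁻¹ := by
  have hm' : (1 : ℝ) ≤ m := by exact_mod_cast hm
  have hlog : 0 ≤ Real.log m := Real.log_nonneg hm'
  have key (b : ℤ → ℝ) (hb : ∀ h, |b h| ≤ 1) :
      P.real {ω | 8 * Real.sqrt (m * Real.log m) ≤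
        |∑ h ∈ Finset.Ioo (-(m : ℤ)) (m : ℤ), b h * ST h ω|} ≤ 2 * ((m : ℝ) ^ 4)⁻¹ := by
    have hV : ∑ h ∈ Finset.Ioo (-(m : ℤ)) (m : ℤ), b h ^ 2 ≤ 2 * m := by
      refine le_trans (Finset.sum_le_sum (g := fun _ => (1 : ℝ)) fun h _ => ?_) ?_
      · rw [← sq_abs]
        exact pow_le_one₀ (abs_nonneg _) (hb h)
      · simpa using card_Ioo_le m
    refine (hST.measureReal_abs_sum_ge_le _ b hV (by positivity)).trans (le_of_eq ?_)
    have e : -(8 * Real.sqrt (m * Real.log m)) ^ 2 / (8 * (2 * m)) = -((4 : ℕ) * Real.log m) := by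
      rw [mul_pow, Real.sq_sqrt (by positivity)]
      field_simp
      push_cast
      ring
    rw [e, Real.exp_neg, Real.exp_nat_mul, Real.exp_log (by positivity)]
  have h1 := key (fun h => a h * Real.cos (2 * Real.pi * (h * t))) fun h => by
    rw [abs_mul]
    exact mul_le_one₀ (ha h) (abs_nonneg _) (Real.abs_cos_le_one _)
  have h2 := key (fun h => a h * Real.sin (2 * Real.pi * (h * t))) fun h => by
    rw [abs_mul]
    exact mul_le_one₀ (ha h) (abs_nonneg _) (Real.abs_sin_le_one _)
  refine le_trans (measureReal_mono fun ω hω => ?_)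
    ((measureReal_union_le _ _).trans ((add_le_add h1 h2).trans (le_of_eq (by ring))))
  have hω' : 16 * Real.sqrt (m * Real.log m) ≤ ‖trigSum (fun h => a h * ST h ω) m t‖ := hω
  have hre : (trigSum (fun h => a h * ST h ω) m t).re =
      ∑ h ∈ Finset.Ioo (-(m : ℤ)) (m : ℤ), (a h * Real.cos (2 * Real.pi * (h * t))) * ST h ω := by
    rw [trigSum, Complex.re_sum]
    refine Finset.sum_congr rfl fun h _ => ?_
    rw [Complex.re_ofReal_mul, re_expi]
    ring
  have him : (trigSum (fun h => a h * ST h ω) m t).im =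
      ∑ h ∈ Finset.Ioo (-(m : ℤ)) (m : ℤ), (a h * Real.sin (2 * Real.pi * (h * t))) * ST h ω := by
    rw [trigSum, Complex.im_sum]
    refine Finset.sum_congr rfl fun h _ => ?_
    rw [Complex.im_ofReal_mul, im_expi]
    ring
  have h3 := Complex.norm_le_abs_re_add_abs_im (trigSum (fun h => a h * ST h ω) m t)
  rw [hre, him] at h3
  by_contra hcon
  simp only [mem_union, mem_ofPred_eq, not_or, not_le] at hcon
  have h4 := hcon.1
  have h5 := hcon.2
  linarith

theorem ae_exists_norm_trigSum_le (hST : IsSatoTateSequence P ST) {a : ℤ → ℝ}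
    (ha : ∀ h, |a h| ≤ 1) : ∀ᵐ ω ∂P, ∀ β : ℝ, 1 / 2 < β → ∃ C, 0 < C ∧ ∀ m : ℕ, 1 ≤ m → ∀ t : ℝ,
      ‖trigSum (fun h => a h * ST h ω) m t‖ ≤ C * (m : ℝ) ^ β := by
  let E : ℕ → Set Ω := fun m => ⋃ g ∈ Finset.range (m ^ 2),
    {ω | 16 * Real.sqrt (m * Real.log m) ≤
      ‖trigSum (fun h => a h * ST h ω) m ((g : ℝ) / (m : ℝ) ^ 2)‖}
  have hE (m : ℕ) (hm : 1 ≤ m) : P.real (E m) ≤ 4 * ((m : ℝ) ^ 2)⁻¹ := by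
    have hm' : (1 : ℝ) ≤ m := by exact_mod_cast hm
    refine (measureReal_biUnion_finset_le _ _).trans ?_
    refine (Finset.sum_le_sum fun g _ => hST.measureReal_norm_trigSum_ge_le ha hm _).trans
      (le_of_eq ?_)
    rw [Finset.sum_const, Finset.card_range, nsmul_eq_mul]
    push_cast
    field_simp
  have hsum : ∑' m, P (E m) ≠ ∞ := by
    have h1 : Summable fun m : ℕ => 4 * ((m : ℝ) ^ 2)⁻¹ :=
      (Real.summable_nat_pow_inv.2 one_lt_two).mul_left 4
    refine ne_top_of_le_ne_top (h1.tsum_ofReal_ne_top) (ENNReal.tsum_le_tsum fun m => ?_)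
    rcases Nat.eq_zero_or_pos m with rfl | hm
    · simp [E]
    · rw [← ENNReal.ofReal_toReal (measure_ne_top P (E m))]
      exact ENNReal.ofReal_le_ofReal (hE m hm)
  filter_upwards [ae_eventually_notMem hsum, hST.ae_abs_le] with ω hω hbd β hβ
  have hx : ∀ h, |a h * ST h ω| ≤ 2 := fun h => by
    rw [abs_mul]
    nlinarith [ha h, hbd h, abs_nonneg (a h), abs_nonneg (ST h ω)]
  obtain ⟨N, hN⟩ := eventually_atTop.1 hω
  set c := 16 / Real.sqrt (2 * β - 1) + 8 * Real.pi with hc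
  have hcpos : 0 < c := by have := Real.pi_pos; positivity
  refine ⟨c + 4 * N, by positivity, fun m hm t => ?_⟩
  have hm' : (1 : ℝ) ≤ m := by exact_mod_cast hm
  have hmβ : (1 : ℝ) ≤ (m : ℝ) ^ β := Real.one_le_rpow hm' (by linarith)
  rcases lt_or_ge m N with h | h
  · have h1 := norm_trigSum_le hx m t
    have h2 : (m : ℝ) ≤ N := by exact_mod_cast h.le
    calc _ ≤ 4 * (m : ℝ) := h1
      _ ≤ (c + 4 * N) * 1 := by nlinarith
      _ ≤ _ := by gcongr
  · have hm2 : (0 : ℝ) < (m : ℝ) ^ 2 := by positivity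
    set u := Int.fract t with hu
    set g := ⌊u * (m : ℝ) ^ 2⌋₊ with hg
    have hu0 : 0 ≤ u := Int.fract_nonneg t
    have hu1 : u < 1 := Int.fract_lt_one t
    have hgle : (g : ℝ) ≤ u * (m : ℝ) ^ 2 := Nat.floor_le (by positivity)
    have hglt : u * (m : ℝ) ^ 2 < g + 1 := Nat.lt_floor_add_one _
    have hgm : g < m ^ 2 := by
      have : (g : ℝ) < (m : ℝ) ^ 2 := by nlinarith
      exact_mod_cast this
    have hdist : |u - g / (m : ℝ) ^ 2| ≤ 1 / (m : ℝ) ^ 2 := by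
      have e : u - g / (m : ℝ) ^ 2 = (u * (m : ℝ) ^ 2 - g) / (m : ℝ) ^ 2 := by field_simp
      rw [e, abs_of_nonneg (div_nonneg (by linarith) hm2.le)]
      gcongr
      linarith
    have h1 : ‖trigSum (fun h => a h * ST h ω) m (g / (m : ℝ) ^ 2)‖ <
        16 * Real.sqrt (m * Real.log m) := by
      have := hN m h
      simp only [E, mem_iUnion, not_exists] at this
      exact not_le.1 (this g (Finset.mem_range.2 hgm))
    have h2 := norm_trigSum_sub_le hx m u (g / (m : ℝ) ^ 2)
    have h3 : trigSum (fun h => a h * ST h ω) m t = trigSum (fun h => a h * ST h ω) m u := by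
      rw [← Int.fract_add_floor t, trigSum_add_int]
    have h4 : 8 * Real.pi * (m : ℝ) ^ 2 * |u - g / (m : ℝ) ^ 2| ≤ 8 * Real.pi := by
      have := Real.pi_pos
      calc _ ≤ 8 * Real.pi * (m : ℝ) ^ 2 * (1 / (m : ℝ) ^ 2) := by gcongr
        _ = _ := by field_simp
    have h5 : Real.sqrt (m * Real.log m) ≤ (m : ℝ) ^ β / Real.sqrt (2 * β - 1) := by
      have hε : 0 < 2 * β - 1 := by linarith
      refine Real.sqrt_le_iff.2 ⟨by positivity, ?_⟩
      have := Real.log_le_rpow_div (by positivity : (0 : ℝ) ≤ m) hε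
      rw [div_pow, Real.sq_sqrt hε.le, ← Real.rpow_natCast, ← Real.rpow_mul (by positivity)]
      calc (m : ℝ) * Real.log m ≤ m * ((m : ℝ) ^ (2 * β - 1) / (2 * β - 1)) := by gcongr
        _ = (m : ℝ) ^ (1 + (2 * β - 1)) / (2 * β - 1) := by
            rw [Real.rpow_add (by positivity), Real.rpow_one]
            ring
        _ = _ := by
            congr 2
            push_cast
            ring
    rw [h3]
    have h6 : ‖trigSum (fun h => a h * ST h ω) m u‖ ≤
        ‖trigSum (fun h => a h * ST h ω) m (g / (m : ℝ) ^ 2)‖ +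
          ‖trigSum (fun h => a h * ST h ω) m u -
            trigSum (fun h => a h * ST h ω) m (g / (m : ℝ) ^ 2)‖ := by
      have := norm_add_le (trigSum (fun h => a h * ST h ω) m (g / (m : ℝ) ^ 2))
        (trigSum (fun h => a h * ST h ω) m u - trigSum (fun h => a h * ST h ω) m (g / (m : ℝ) ^ 2))
      simpa using this
    have h7 : 16 / Real.sqrt (2 * β - 1) * (m : ℝ) ^ β =
        16 * ((m : ℝ) ^ β / Real.sqrt (2 * β - 1)) := by ring
    calc ‖trigSum (fun h => a h * ST h ω) m u‖
        ≤ 16 / Real.sqrt (2 * β - 1) * (m : ℝ) ^ β + 8 * Real.pi * 1 := by rw [h7]; linarith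
      _ ≤ 16 / Real.sqrt (2 * β - 1) * (m : ℝ) ^ β + 8 * Real.pi * (m : ℝ) ^ β := by
          have := Real.pi_pos
          gcongr
      _ = c * (m : ℝ) ^ β := by rw [hc]; ring
      _ ≤ (c + 4 * N) * (m : ℝ) ^ β := by
          gcongr
          have : (0 : ℝ) ≤ N := by positivity
          linarith

end IsSatoTateSequence
section Deterministic

variable {Ω : Type*} {ST : ℤ → Ω → ℝ} {ω : Ω}

theorem hasDerivAt_coeff (h : ℤ) (t : ℝ) : HasDerivAt (coeff h) (expi (h * t)) t := by
  by_cases hh : h = 0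
  · subst hh
    have e : coeff 0 = fun t : ℝ => (t : ℂ) := by
      ext t
      simp [coeff]
    rw [e]
    simpa [expi_zero] using (hasDerivAt_id t).ofReal_comp
  · have e : coeff h = fun t : ℝ => (expi (h * t) - 1) / (2 * Real.pi * Complex.I * h) := by
      ext t
      exact coeff_of_ne_zero hh t
    rw [e]
    have h1 : HasDerivAt (fun t : ℝ => (h : ℝ) * t) h t := by
      simpa using (hasDerivAt_id t).const_mul (h : ℝ)
    have h2 := (((hasDerivAt_expi (h * t)).scomp t h1).sub_const 1).div_const
      (2 * Real.pi * Complex.I * h)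
    convert! h2 using 1
    have : (h : ℂ) ≠ 0 := by exact_mod_cast hh
    have : (Real.pi : ℂ) ≠ 0 := by exact_mod_cast Real.pi_ne_zero
    simp only [Complex.real_smul, Complex.ofReal_intCast]
    field_simp

theorem hasDerivAt_partialSum (m : ℕ) (t : ℝ) :
    HasDerivAt (fun t => partialSum ST m t ω) (trigSum (fun h => ST h ω) m t) t := by
  unfold partialSum trigSum
  refine HasDerivAt.fun_sum fun h _ => ?_
  rw [mul_comm]
  exact (hasDerivAt_coeff h t).mul_const _

theorem norm_partialSum_sub_le {m : ℕ} {B : ℝ}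
    (hB : ∀ t, ‖trigSum (fun h => ST h ω) m t‖ ≤ B) (s t : ℝ) :
    ‖partialSum ST m s ω - partialSum ST m t ω‖ ≤ B * |s - t| :=
  Convex.norm_image_sub_le_of_norm_hasDerivWithin_le (s := univ)
    (fun x _ => (hasDerivAt_partialSum m x).hasDerivWithinAt) (fun x _ => hB x) convex_univ
    trivial trivial

/-- The sum `∑_{|h| < m} sgn(h) x_h (e^{2πiht} - 1)`. -/
noncomputable def oddSum (x : ℤ → ℝ) (m : ℕ) (t : ℝ) : ℂ :=
  trigSum (fun h => (h.sign : ℝ) * x h) m t - trigSum (fun h => (h.sign : ℝ) * x h) m 0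

theorem partialSum_succ_sub {m : ℕ} (hm : 1 ≤ m) (t : ℝ) :
    2 * Real.pi * Complex.I * (partialSum ST (m + 1) t ω - partialSum ST m t ω) =
      (oddSum (fun h => ST h ω) (m + 1) t - oddSum (fun h => ST h ω) m t) / m := by
  have hne : (m : ℤ) ≠ 0 := by omega
  have hpos : (0 : ℤ) < m := by omega
  have hmC : (m : ℂ) ≠ 0 := by exact_mod_cast (by omega : m ≠ 0)
  have hpi : (Real.pi : ℂ) ≠ 0 := by exact_mod_cast Real.pi_ne_zero
  simp only [partialSum, oddSum, trigSum]
  rw [sum_Ioo_succ _ hm, sum_Ioo_succ _ hm, sum_Ioo_succ _ hm, coeff_of_ne_zero hne,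
    coeff_of_ne_zero (neg_ne_zero.2 hne), Int.sign_neg, Int.sign_eq_one_of_pos hpos]
  simp only [mul_zero, expi_zero]
  push_cast
  field_simp
  ring

theorem rpow_telescope {β : ℝ} (hβ : β < 1) (hβ0 : 0 ≤ β) {j : ℕ} (hj : 1 ≤ j) :
    ((j + 1 : ℕ) : ℝ) ^ (β - 1) / j ≤
      2 / (1 - β) * ((j : ℝ) ^ (β - 1) - ((j + 1 : ℕ) : ℝ) ^ (β - 1)) := by
  have hj' : (1 : ℝ) ≤ j := by exact_mod_cast hj
  set p := 1 - β with hp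
  have hp0 : 0 < p := by linarith
  have e : β - 1 = -p := by ring
  rw [e]
  push_cast
  have h1 := rpow_one_add_le_one_add_mul_self (s := -(1 / ((j : ℝ) + 1)))
    (by rw [neg_le_neg_iff, div_le_one (by positivity)]; linarith) hp0.le (by linarith : p ≤ 1)
  have e2 : 1 + -(1 / ((j : ℝ) + 1)) = j / (j + 1) := by field_simp; ring
  rw [e2, Real.div_rpow (by positivity) (by positivity)] at h1
  have hA : 0 < (j : ℝ) ^ p := by positivity
  have hB : 0 < ((j : ℝ) + 1) ^ p := by positivity
  rw [Real.rpow_neg (by positivity), Real.rpow_neg (by positivity)]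
  set A := (j : ℝ) ^ p
  set B := ((j : ℝ) + 1) ^ p
  rw [div_le_iff₀ hB] at h1
  have h2 : A * (j + 1) ≤ B * (j + 1 - p) := by
    calc A * (j + 1) ≤ (1 + p * -(1 / ((j : ℝ) + 1))) * B * (j + 1) := by gcongr
      _ = B * (j + 1 - p) := by field_simp; ring
  have h3 : p * A ≤ (B - A) * (j + 1) := by
    have hAB : A ≤ B := by
      have : A * (j + 1) ≤ B * (j + 1) := h2.trans (by gcongr; linarith)
      exact le_of_mul_le_mul_right this (by positivity)
    nlinarith
  have h4 : p * A ≤ 2 * (B - A) * j := by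
    have hAB : A ≤ B := by
      have : A * (j + 1) ≤ B * (j + 1) := h2.trans (by gcongr; linarith)
      exact le_of_mul_le_mul_right this (by positivity)
    nlinarith
  have e3 : 2 / p * (A⁻¹ - B⁻¹) = 2 * (B - A) / (p * A * B) := by field_simp
  have e4 : B⁻¹ / j = 1 / (B * j) := by field_simp
  rw [e3, e4, div_le_div_iff₀ (by positivity) (by positivity)]
  nlinarith

theorem norm_partialSum_sub_partialSum_le {C β : ℝ} (hC : 0 < C) (hβ0 : 0 ≤ β) (hβ : β < 1)
    (hQ : ∀ m : ℕ, 1 ≤ m → ∀ t, ‖trigSum (fun h => (h.sign : ℝ) * ST h ω) m t‖ ≤ C * (m : ℝ) ^ β)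
    {m M : ℕ} (hm : 1 ≤ m) (hM : m ≤ M) (t : ℝ) :
    ‖partialSum ST M t ω - partialSum ST m t ω‖ ≤ (4 * C + 4 * C / (1 - β)) * (m : ℝ) ^ (β - 1) := by
  set R := fun m => oddSum (fun h => ST h ω) m t with hR
  have hRle (m : ℕ) (hm : 1 ≤ m) : ‖R m‖ ≤ 2 * C * (m : ℝ) ^ β := by
    refine (norm_sub_le _ _).trans ?_
    linarith [hQ m hm t, hQ m hm 0]
  have hRdiv (m : ℕ) (hm : 1 ≤ m) : ‖R m / m‖ ≤ 2 * C * (m : ℝ) ^ (β - 1) := by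
    have hm' : (0 : ℝ) < m := by exact_mod_cast hm
    rw [norm_div, Complex.norm_natCast, div_le_iff₀ hm', mul_assoc,
      ← Real.rpow_add_one hm'.ne', sub_add_cancel]
    exact hRle m hm
  have key : ‖2 * Real.pi * Complex.I * (partialSum ST M t ω - partialSum ST m t ω) -
      (R M / M - R m / m)‖ ≤ 4 * C / (1 - β) * ((m : ℝ) ^ (β - 1) - (M : ℝ) ^ (β - 1)) := by
    induction M, hM using Nat.le_induction with
    | base => simp
    | succ M hM ih =>
      have hM1 : 1 ≤ M := hm.trans hM
      have hMC : (M : ℂ) ≠ 0 := by exact_mod_cast (by omega : M ≠ 0)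
      have hMC1 : ((M : ℂ) + 1) ≠ 0 := by exact_mod_cast (by omega : M + 1 ≠ 0)
      have hMpos : (0 : ℝ) < M := by exact_mod_cast hM1
      have e : 2 * Real.pi * Complex.I * (partialSum ST (M + 1) t ω - partialSum ST m t ω) -
          (R (M + 1) / ((M + 1 : ℕ) : ℂ) - R m / m) =
          (2 * Real.pi * Complex.I * (partialSum ST M t ω - partialSum ST m t ω) -
            (R M / M - R m / m)) + R (M + 1) / ((M + 1 : ℕ) : ℂ) / M := by
        have h1 := partialSum_succ_sub (ST := ST) (ω := ω) hM1 t
        change _ = (R (M + 1) - R M) / M at h1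
        have h2 : 2 * Real.pi * Complex.I * (partialSum ST (M + 1) t ω - partialSum ST m t ω) =
            2 * Real.pi * Complex.I * (partialSum ST M t ω - partialSum ST m t ω) +
              (R (M + 1) - R M) / M := by
          rw [← h1]
          ring
        rw [h2]
        push_cast
        field_simp
        ring
      rw [e]
      refine (norm_add_le _ _).trans ?_
      have h3 : ‖R (M + 1) / ((M + 1 : ℕ) : ℂ) / M‖ ≤
          2 * C * (((M + 1 : ℕ) : ℝ) ^ (β - 1) / M) := by
        rw [norm_div, Complex.norm_natCast, ← mul_div_assoc]
        gcongr
        exact hRdiv (M + 1) (by omega)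
      have h4 := rpow_telescope hβ hβ0 hM1
      have h5 := mul_le_mul_of_nonneg_left h4 (by positivity : 0 ≤ 2 * C)
      have h6 : 2 * C * (2 / (1 - β) * ((M : ℝ) ^ (β - 1) - ((M + 1 : ℕ) : ℝ) ^ (β - 1))) =
          4 * C / (1 - β) * ((M : ℝ) ^ (β - 1) - ((M + 1 : ℕ) : ℝ) ^ (β - 1)) := by ring
      rw [h6] at h5
      calc _ ≤ 4 * C / (1 - β) * ((m : ℝ) ^ (β - 1) - (M : ℝ) ^ (β - 1)) +
            4 * C / (1 - β) * ((M : ℝ) ^ (β - 1) - ((M + 1 : ℕ) : ℝ) ^ (β - 1)) :=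
              add_le_add ih (h3.trans h5)
        _ = _ := by ring
  have hM1 : 1 ≤ M := hm.trans hM
  have hm' : (0 : ℝ) < m := by exact_mod_cast hm
  have hMm : (M : ℝ) ^ (β - 1) ≤ (m : ℝ) ^ (β - 1) :=
    Real.rpow_le_rpow_of_nonpos hm' (by exact_mod_cast hM) (by linarith)
  have hM0 : 0 ≤ (M : ℝ) ^ (β - 1) := by positivity
  have hD : 0 ≤ 4 * C / (1 - β) := by
    have : 0 < 1 - β := by linarith
    positivity
  set d := partialSum ST M t ω - partialSum ST m t ω with hd
  have h1 : ‖2 * Real.pi * Complex.I * d‖ ≤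
      (4 * C + 4 * C / (1 - β)) * (m : ℝ) ^ (β - 1) := by
    have h2 : ‖2 * Real.pi * Complex.I * d‖ ≤
        ‖2 * Real.pi * Complex.I * d - (R M / M - R m / m)‖ + ‖R M / M - R m / m‖ := by
      have := norm_add_le (2 * Real.pi * Complex.I * d - (R M / M - R m / m))
        (R M / M - R m / m)
      rwa [sub_add_cancel] at this
    have h3 := norm_sub_le (R M / M) (R m / m)
    have h4 := hRdiv M hM1
    have h5 := hRdiv m hm
    nlinarith
  have h2 : ‖2 * Real.pi * Complex.I * d‖ = 2 * Real.pi * ‖d‖ := by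
    simp [abs_of_pos Real.pi_pos]
  rw [h2] at h1
  nlinarith [Real.pi_gt_three, norm_nonneg d]

/-- Uniform control of the path: the rate of convergence of the partial sums and the Hölder
modulus of continuity. -/
def IsRegularPath (ST : ℤ → Ω → ℝ) (ω : Ω) : Prop :=
  ∀ β : ℝ, 1 / 2 < β → β < 1 → ∃ C, 0 < C ∧
    (∀ m : ℕ, 1 ≤ m → ∀ t, ‖K ST t ω - partialSum ST m t ω‖ ≤ C * (m : ℝ) ^ (β - 1)) ∧
    (∀ s t, |s - t| ≤ 1 → ‖K ST s ω - K ST t ω‖ ≤ C * |s - t| ^ (1 - β))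

theorem tendsto_natCast_rpow_sub_one {β : ℝ} (hβ : β < 1) (C : ℝ) :
    Tendsto (fun m : ℕ => C * (m : ℝ) ^ (β - 1)) atTop (𝓝 0) := by
  have h := (tendsto_rpow_neg_atTop (by linarith : 0 < 1 - β)).comp tendsto_natCast_atTop_atTop
  have e : β - 1 = -(1 - β) := by ring
  rw [e]
  simpa using h.const_mul C

theorem tendsto_partialSum_of_le {C β : ℝ} (hβ : β < 1) {t : ℝ}
    (h : ∀ m M : ℕ, 1 ≤ m → m ≤ M →
      ‖partialSum ST M t ω - partialSum ST m t ω‖ ≤ C * (m : ℝ) ^ (β - 1)) :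
    Tendsto (fun m => partialSum ST m t ω) atTop (𝓝 (K ST t ω)) := by
  have hc : CauchySeq fun m => partialSum ST (m + 1) t ω := by
    refine cauchySeq_of_le_tendsto_0' (fun m : ℕ => C * ((m + 1 : ℕ) : ℝ) ^ (β - 1)) ?_
      ((tendsto_add_atTop_iff_nat (f := fun m : ℕ => C * (m : ℝ) ^ (β - 1)) 1).2 (tendsto_natCast_rpow_sub_one hβ C))
    intro m M hmM
    rw [dist_comm, dist_eq_norm]
    exact h (m + 1) (M + 1) (by omega) (by omega)
  obtain ⟨l, hl⟩ := cauchySeq_tendsto_of_complete hc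
  have hl' : Tendsto (fun m => partialSum ST m t ω) atTop (𝓝 l) :=
    (tendsto_add_atTop_iff_nat (f := fun m => partialSum ST m t ω) 1).1 hl
  have hKl : K ST t ω = l := hl'.limUnder_eq
  rwa [hKl]

theorem isRegularPath_of_trigSum_le
    (hP : ∀ β : ℝ, 1 / 2 < β → ∃ C, 0 < C ∧ ∀ m : ℕ, 1 ≤ m → ∀ t : ℝ,
      ‖trigSum (fun h => ST h ω) m t‖ ≤ C * (m : ℝ) ^ β)
    (hQ : ∀ β : ℝ, 1 / 2 < β → ∃ C, 0 < C ∧ ∀ m : ℕ, 1 ≤ m → ∀ t : ℝ,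
      ‖trigSum (fun h => (h.sign : ℝ) * ST h ω) m t‖ ≤ C * (m : ℝ) ^ β) :
    IsRegularPath ST ω := by
  intro β hβ hβ1
  obtain ⟨C₁, hC₁, H₁⟩ := hP β hβ
  obtain ⟨C₂, hC₂, H₂⟩ := hQ β hβ
  have hβ' : 0 < 1 - β := by linarith
  set D := 4 * C₂ + 4 * C₂ / (1 - β) with hD
  have hDpos : 0 < D := by positivity
  have hcauchy (t : ℝ) (m M : ℕ) (hm : 1 ≤ m) (hM : m ≤ M) :
      ‖partialSum ST M t ω - partialSum ST m t ω‖ ≤ D * (m : ℝ) ^ (β - 1) :=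
    norm_partialSum_sub_partialSum_le hC₂ (by linarith) hβ1 H₂ hm hM t
  have hrate (m : ℕ) (hm : 1 ≤ m) (t : ℝ) :
      ‖K ST t ω - partialSum ST m t ω‖ ≤ D * (m : ℝ) ^ (β - 1) := by
    refine le_of_tendsto ((tendsto_partialSum_of_le hβ1 (hcauchy t)).sub_const _).norm ?_
    filter_upwards [eventually_ge_atTop m] with M hM
    exact hcauchy t m M hm hM
  refine ⟨2 * D + 4 * C₁, by positivity, fun m hm t => (hrate m hm t).trans ?_, fun s t hst => ?_⟩
  · gcongr
    linarith
  · rcases eq_or_ne s t with rfl | hne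
    · simp [Real.zero_rpow hβ'.ne']
    set d := |s - t| with hd
    have hd0 : 0 < d := abs_pos.2 (sub_ne_zero.2 hne)
    set m := ⌈1 / d⌉₊ with hm
    have hm1 : 1 / d ≤ m := Nat.le_ceil _
    have hm2 : (m : ℝ) < 1 / d + 1 := Nat.ceil_lt_add_one (by positivity)
    have hd1 : 1 ≤ 1 / d := by rw [le_div_iff₀ hd0]; linarith
    have hm3 : (m : ℝ) ≤ 2 / d := by
      have : 2 / d = 1 / d + 1 / d := by ring
      linarith
    have hmnat : 1 ≤ m := by
      have : (1 : ℝ) ≤ m := hd1.trans hm1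
      exact_mod_cast this
    have h1 : (m : ℝ) ^ (β - 1) ≤ d ^ (1 - β) := by
      calc (m : ℝ) ^ (β - 1) ≤ (1 / d) ^ (β - 1) :=
            Real.rpow_le_rpow_of_nonpos (by positivity) hm1 (by linarith)
        _ = d ^ (1 - β) := by
            rw [one_div, Real.inv_rpow hd0.le, ← Real.rpow_neg hd0.le]
            congr 1
            ring
    have h2 : (m : ℝ) ^ β * d ≤ 2 * d ^ (1 - β) := by
      calc (m : ℝ) ^ β * d ≤ (2 / d) ^ β * d := by gcongr
        _ = 2 ^ β * d ^ (1 - β) := by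
            rw [Real.div_rpow (by norm_num) hd0.le, Real.rpow_sub hd0, Real.rpow_one]
            ring
        _ ≤ 2 ^ (1 : ℝ) * d ^ (1 - β) := by
            gcongr
            norm_num
        _ = _ := by rw [Real.rpow_one]
    have h3 := norm_partialSum_sub_le (fun t => H₁ m hmnat t) s t
    have h4 := hrate m hmnat s
    have h5 := hrate m hmnat t
    have e : K ST s ω - K ST t ω = (K ST s ω - partialSum ST m s ω) +
        (partialSum ST m s ω - partialSum ST m t ω) - (K ST t ω - partialSum ST m t ω) := by ring
    rw [e]
    refine (norm_sub_le _ _).trans ((add_le_add_left (norm_add_le _ _) _).trans ?_)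
    have h6 : D * (m : ℝ) ^ (β - 1) ≤ D * d ^ (1 - β) := by gcongr
    have h7 : C₁ * (m : ℝ) ^ β * d ≤ C₁ * (2 * d ^ (1 - β)) := by
      rw [mul_assoc]
      gcongr
    have h8 : 0 ≤ C₁ * d ^ (1 - β) := by positivity
    linarith

theorem IsRegularPath.tendsto (h : IsRegularPath ST ω) (t : ℝ) :
    Tendsto (fun m => partialSum ST m t ω) atTop (𝓝 (K ST t ω)) := by
  obtain ⟨C, -, H, -⟩ := h (3 / 4) (by norm_num) (by norm_num)
  rw [tendsto_iff_norm_sub_tendsto_zero]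
  refine squeeze_zero' (Eventually.of_forall fun _ => norm_nonneg _) ?_
    (tendsto_natCast_rpow_sub_one (by norm_num : (3 / 4 : ℝ) < 1) C)
  filter_upwards [eventually_ge_atTop 1] with m hm
  rw [norm_sub_rev]
  exact H m hm t

theorem IsRegularPath.holderOnWith (h : IsRegularPath ST ω) {α : ℝ≥0} (hα : 0 < α)
    (hα2 : α < 1 / 2) : ∃ c : ℝ≥0, HolderOnWith c α (fun t => K ST t ω) (Icc 0 1) := by
  have hα' : (α : ℝ) < 1 / 2 := by exact_mod_cast hα2
  have hα0 : (0 : ℝ) < α := by exact_mod_cast hα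
  obtain ⟨C, hC, -, H⟩ := h (1 - α) (by linarith) (by linarith)
  refine ⟨C.toNNReal, fun s hs t ht => ?_⟩
  have h1 := H s t (by rw [abs_le]; constructor <;> linarith [hs.1, hs.2, ht.1, ht.2])
  rw [edist_eq_enorm_sub, edist_eq_enorm_sub, ← ofReal_norm, ← ofReal_norm, Real.norm_eq_abs,
    ENNReal.ofReal_rpow_of_nonneg (abs_nonneg _) hα0.le]
  change _ ≤ ENNReal.ofReal C * _
  rw [← ENNReal.ofReal_mul hC.le]
  refine ENNReal.ofReal_le_ofReal ?_
  simpa using h1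

theorem IsRegularPath.continuous (h : IsRegularPath ST ω) : Continuous fun t => K ST t ω := by
  obtain ⟨C, hC, -, H⟩ := h (3 / 4) (by norm_num) (by norm_num)
  rw [continuous_iff_continuousAt]
  intro t
  rw [ContinuousAt, tendsto_iff_norm_sub_tendsto_zero]
  have h1 : Tendsto (fun s : ℝ => C * |s - t| ^ (1 - 3 / 4 : ℝ)) (𝓝 t) (𝓝 0) := by
    have h2 : Continuous fun s : ℝ => C * |s - t| ^ (1 - 3 / 4 : ℝ) :=
      continuous_const.mul ((continuous_abs.comp (continuous_sub_right t)).rpow_const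
        fun _ => Or.inr (by norm_num))
    have h3 := h2.tendsto t
    simpa [Real.zero_rpow (by norm_num : (1 - 3 / 4 : ℝ) ≠ 0)] using h3
  refine squeeze_zero' (Eventually.of_forall fun _ => norm_nonneg _) ?_ h1
  filter_upwards [Metric.ball_mem_nhds t one_pos] with s hs
  refine H s t ?_
  rw [Metric.mem_ball, Real.dist_eq] at hs
  exact hs.le

end Deterministic

theorem IsSatoTateSequence.ae_isRegularPath {Ω : Type*} [MeasurableSpace Ω] {P : Measure Ω}
    [IsProbabilityMeasure P] {ST : ℤ → Ω → ℝ} (hST : IsSatoTateSequence P ST) :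
    ∀ᵐ ω ∂P, IsRegularPath ST ω := by
  have h1 := hST.ae_exists_norm_trigSum_le (a := fun _ => 1) (by simp)
  have h2 := hST.ae_exists_norm_trigSum_le (a := fun h => (h.sign : ℝ)) fun h => by
    rcases lt_trichotomy h 0 with hh | rfl | hh
    · simp [Int.sign_eq_neg_one_of_neg hh]
    · simp
    · simp [Int.sign_eq_one_of_pos hh]
  filter_upwards [h1, h2] with ω hω1 hω2
  simp only [one_mul] at hω1
  exact isRegularPath_of_trigSum_le hω1 hω2

theorem integral_expi (n : ℤ) :
    ∫ u in (-(1 / 2) : ℝ)..(1 / 2), expi (n * u) = if n = 0 then 1 else 0 := by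
  split_ifs with hn
  · subst hn
    simp [expi_zero]
    norm_num
  · have hnC : (n : ℂ) ≠ 0 := by exact_mod_cast hn
    have hpi : (Real.pi : ℂ) ≠ 0 := by exact_mod_cast Real.pi_ne_zero
    have h0 : (2 * Real.pi * Complex.I * n : ℂ) ≠ 0 := by simp [hnC, hpi]
    have h1 (u : ℝ) : expi (n * u) = Complex.exp ((2 * Real.pi * Complex.I * n) * u) := by
      rw [expi]
      push_cast
      ring_nf
    simp_rw [h1]
    rw [integral_exp_mul_complex h0, ← h1, ← h1]
    have h2 : expi (n * (1 / 2)) = expi (n * -(1 / 2)) := by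
      have : (n : ℝ) * (1 / 2) = n * -(1 / 2) + n := by ring
      rw [this, expi_add, expi_int, mul_one]
    rw [h2]
    simp

theorem conj_expi (x : ℝ) : (starRingEnd ℂ) (expi x) = expi (-x) := by
  rw [expi_eq, expi_eq, ← Complex.exp_conj]
  congr 1
  rw [map_mul, Complex.conj_ofReal, Complex.conj_I]
  push_cast
  ring

theorem norm_sq_sum_expi (a : ℕ → ℝ) (k : ℕ) (u : ℝ) :
    ((‖∑ j ∈ Finset.range k, (a j : ℂ) * expi (j * u)‖ ^ 2 : ℝ) : ℂ) =
      ∑ i ∈ Finset.range k, ∑ j ∈ Finset.range k, ((a i * a j : ℝ) : ℂ) * expi ((i - j) * u) := by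
  rw [← Complex.normSq_eq_norm_sq, ← Complex.mul_conj, map_sum, Finset.sum_mul_sum]
  refine Finset.sum_congr rfl fun i _ => Finset.sum_congr rfl fun j _ => ?_
  rw [map_mul, conj_expi, Complex.conj_ofReal, sub_mul, sub_eq_add_neg, expi_add]
  push_cast
  ring

theorem integral_norm_sq_mul_expi (a : ℕ → ℝ) (k : ℕ) (n : ℤ) :
    ∫ u in (-(1 / 2) : ℝ)..(1 / 2),
      ((‖∑ j ∈ Finset.range k, (a j : ℂ) * expi (j * u)‖ ^ 2 : ℝ) : ℂ) * expi (n * u) =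
      ((∑ i ∈ Finset.range k, ∑ j ∈ Finset.range k,
        if (i : ℤ) + n = j then a i * a j else 0 : ℝ) : ℂ) := by
  have h1 (u : ℝ) : ((‖∑ j ∈ Finset.range k, (a j : ℂ) * expi (j * u)‖ ^ 2 : ℝ) : ℂ) *
      expi (n * u) = ∑ i ∈ Finset.range k, ∑ j ∈ Finset.range k,
        ((a i * a j : ℝ) : ℂ) * expi (((i - j + n : ℤ) : ℝ) * u) := by
    rw [norm_sq_sum_expi, Finset.sum_mul]
    refine Finset.sum_congr rfl fun i _ => ?_
    rw [Finset.sum_mul]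
    refine Finset.sum_congr rfl fun j _ => ?_
    rw [mul_assoc, ← expi_add, ← add_mul]
    push_cast
    rfl
  have hc (c : ℂ) (l : ℤ) : IntervalIntegrable (fun u : ℝ => c * expi ((l : ℝ) * u)) volume
      (-(1 / 2)) (1 / 2) :=
    (continuous_const.mul (continuous_expi.comp (continuous_const.mul continuous_id)))
      |>.intervalIntegrable _ _
  simp_rw [h1]
  rw [intervalIntegral.integral_finsetSum]
  · rw [Complex.ofReal_sum]
    refine Finset.sum_congr rfl fun i _ => ?_
    rw [Complex.ofReal_sum, intervalIntegral.integral_finsetSum fun j _ => hc _ _]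
    refine Finset.sum_congr rfl fun j _ => ?_
    rw [intervalIntegral.integral_const_mul, integral_expi]
    have : ((i : ℤ) - j + n = 0) ↔ ((i : ℤ) + n = j) := by omega
    simp only [this]
    split_ifs <;> simp
  · intro i _
    exact (continuous_finsetSum _ fun j _ => continuous_const.mul
      (continuous_expi.comp (continuous_const.mul continuous_id))).intervalIntegrable _ _

theorem integral_norm_sq_sum_expi (a : ℕ → ℝ) (k : ℕ) :
    ∫ u in (-(1 / 2) : ℝ)..(1 / 2), ‖∑ j ∈ Finset.range k, (a j : ℂ) * expi (j * u)‖ ^ 2 =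
      ∑ j ∈ Finset.range k, a j ^ 2 := by
  have h := integral_norm_sq_mul_expi a k 0
  simp only [Int.cast_zero, zero_mul, expi_zero, mul_one, add_zero, Nat.cast_inj,
    Finset.sum_ite_eq] at h
  rw [intervalIntegral.integral_ofReal] at h
  have h2 := Complex.ofReal_injective h
  rw [h2]
  refine Finset.sum_congr rfl fun i hi => ?_
  rw [if_pos hi, sq]

/-- The coefficients `j (k - j)` of the polynomial whose squared modulus is the kernel. -/
def bump (k : ℕ) (j : ℕ) : ℝ := j * (k - j)

theorem sum_bump (k : ℕ) : ∑ j ∈ Finset.range k, bump k j = ((k : ℝ) ^ 3 - k) / 6 := by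
  have h (n : ℕ) : ∑ j ∈ Finset.range n, bump k j =
      k * n * (n - 1) / 2 - n * (n - 1) * (2 * n - 1) / 6 := by
    induction n with
    | zero => simp
    | succ n ih =>
      rw [Finset.sum_range_succ, ih, bump]
      push_cast
      ring
  rw [h]
  ring

theorem sum_bump_sq (k : ℕ) :
    ∑ j ∈ Finset.range k, bump k j ^ 2 = ((k : ℝ) ^ 3 - k) * (k ^ 2 + 1) / 30 := by
  have h (n : ℕ) : ∑ j ∈ Finset.range n, bump k j ^ 2 =
      k ^ 2 * (n * (n - 1) * (2 * n - 1) / 6) - 2 * k * (n * (n - 1) / 2) ^ 2 +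
        n * (n - 1) * (2 * n - 1) * (3 * n ^ 2 - 3 * n - 1) / 30 := by
    induction n with
    | zero => simp
    | succ n ih =>
      rw [Finset.sum_range_succ, ih, bump]
      push_cast
      ring
  rw [h]
  ring

theorem sum_bump_diff_sq (k : ℕ) :
    ∑ j ∈ Finset.range k, (bump k (j + 1) - bump k j) ^ 2 = ((k : ℝ) ^ 3 - k) / 3 := by
  have h (n : ℕ) : ∑ j ∈ Finset.range n, (bump k (j + 1) - bump k j) ^ 2 =
      (k - 1) ^ 2 * n - 4 * (k - 1) * (n * (n - 1) / 2) +
        4 * (n * (n - 1) * (2 * n - 1) / 6) := by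
    induction n with
    | zero => simp
    | succ n ih =>
      rw [Finset.sum_range_succ, ih, bump, bump]
      push_cast
      ring
  rw [h]
  ring

theorem cube_sub_pos {k : ℕ} (hk : 2 ≤ k) : 0 < (k : ℝ) ^ 3 - k := by
  have : (2 : ℝ) ≤ k := by exact_mod_cast hk
  nlinarith [sq_nonneg ((k : ℝ) - 1)]

theorem sum_bump_sq_pos {k : ℕ} (hk : 2 ≤ k) : 0 < ∑ j ∈ Finset.range k, bump k j ^ 2 := by
  rw [sum_bump_sq]
  have := cube_sub_pos hk
  positivity

/-- The trigonometric polynomial whose squared modulus is the kernel. -/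
noncomputable def bumpPoly (k : ℕ) (u : ℝ) : ℂ :=
  ∑ j ∈ Finset.range k, (bump k j : ℂ) * expi (j * u)

/-- A nonnegative trigonometric polynomial of degree `< k`, of mean one, with second moment of
order `k⁻²`. -/
noncomputable def jker (k : ℕ) (u : ℝ) : ℝ :=
  ‖bumpPoly k u‖ ^ 2 / ∑ j ∈ Finset.range k, bump k j ^ 2

theorem continuous_bumpPoly (k : ℕ) : Continuous (bumpPoly k) :=
  continuous_finsetSum _ fun _ _ =>
    continuous_const.mul (continuous_expi.comp (continuous_const.mul continuous_id))

theorem continuous_jker (k : ℕ) : Continuous (jker k) :=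
  ((continuous_bumpPoly k).norm.pow 2).div_const _

theorem jker_nonneg (k : ℕ) (u : ℝ) : 0 ≤ jker k u :=
  div_nonneg (by positivity) (Finset.sum_nonneg fun _ _ => sq_nonneg _)

theorem integral_jker {k : ℕ} (hk : 2 ≤ k) : ∫ u in (-(1 / 2) : ℝ)..(1 / 2), jker k u = 1 := by
  unfold jker bumpPoly
  rw [intervalIntegral.integral_div, integral_norm_sq_sum_expi,
    div_self (sum_bump_sq_pos hk).ne']

/-- The Fourier coefficients of the kernel. -/
noncomputable def jcoeff (k : ℕ) (n : ℤ) : ℝ :=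
  (∑ i ∈ Finset.range k, ∑ j ∈ Finset.range k,
    if (i : ℤ) + n = j then bump k i * bump k j else 0) / ∑ j ∈ Finset.range k, bump k j ^ 2

theorem integral_jker_mul_expi (k : ℕ) (n : ℤ) :
    ∫ u in (-(1 / 2) : ℝ)..(1 / 2), (jker k u : ℂ) * expi (n * u) = jcoeff k n := by
  have h (u : ℝ) : (jker k u : ℂ) * expi (n * u) =
      (((‖bumpPoly k u‖ ^ 2 : ℝ) : ℂ) * expi (n * u)) /
        ((∑ j ∈ Finset.range k, bump k j ^ 2 : ℝ) : ℂ) := by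
    rw [jker, Complex.ofReal_div]
    ring
  simp_rw [h]
  unfold bumpPoly
  rw [intervalIntegral.integral_div, integral_norm_sq_mul_expi, jcoeff, Complex.ofReal_div]

theorem abs_jcoeff_le_one {k : ℕ} (hk : 2 ≤ k) (n : ℤ) : |jcoeff k n| ≤ 1 := by
  rw [← Real.norm_eq_abs, ← Complex.norm_real, ← integral_jker_mul_expi]
  refine (intervalIntegral.norm_integral_le_of_norm_le (g := jker k) (by norm_num)
    (ae_of_all _ fun u _ => ?_) ((continuous_jker k).intervalIntegrable _ _)).trans
    (integral_jker hk).le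
  rw [norm_mul, norm_expi, mul_one, Complex.norm_real, Real.norm_of_nonneg (jker_nonneg k u)]

theorem jcoeff_eq_zero {k : ℕ} {n : ℤ} (hn : (k : ℤ) ≤ |n|) : jcoeff k n = 0 := by
  rw [jcoeff, div_eq_zero_iff]
  left
  refine Finset.sum_eq_zero fun i hi => Finset.sum_eq_zero fun j hj => if_neg ?_
  rw [Finset.mem_range] at hi hj
  rcases abs_cases n with ⟨h, _⟩ | ⟨h, _⟩ <;> omega

theorem jcoeff_neg (k : ℕ) (n : ℤ) : jcoeff k (-n) = jcoeff k n := by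
  rw [jcoeff, jcoeff, Finset.sum_comm]
  congr 1
  refine Finset.sum_congr rfl fun i _ => Finset.sum_congr rfl fun j _ => ?_
  have : ((j : ℤ) + -n = i) ↔ ((i : ℤ) + n = j) := by omega
  simp only [this, mul_comm]

theorem half_le_sum_jcoeff {k : ℕ} (hk : 2 ≤ k) :
    (k : ℝ) / 2 ≤ ∑ n ∈ Finset.Ioo (-(k : ℤ)) k, jcoeff k n := by
  have h1 : ∑ n ∈ Finset.Ioo (-(k : ℤ)) k, jcoeff k n =
      (∑ j ∈ Finset.range k, bump k j) ^ 2 / ∑ j ∈ Finset.range k, bump k j ^ 2 := by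
    unfold jcoeff
    rw [← Finset.sum_div]
    congr 1
    rw [Finset.sum_comm, sq, Finset.sum_mul_sum]
    refine Finset.sum_congr rfl fun i hi => ?_
    rw [Finset.sum_comm]
    refine Finset.sum_congr rfl fun j hj => ?_
    have h2 (n : ℤ) : ((i : ℤ) + n = j) ↔ (n = (j : ℤ) - i) := by omega
    simp only [h2]
    rw [Finset.sum_ite_eq', if_pos]
    rw [Finset.mem_range] at hi hj
    rw [Finset.mem_Ioo]
    omega
  have hk' : (2 : ℝ) ≤ k := by exact_mod_cast hk
  have hpos := cube_sub_pos hk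
  rw [h1, sum_bump, sum_bump_sq]
  have e (X : ℝ) (hX : 0 < X) : (X / 6) ^ 2 / (X * ((k : ℝ) ^ 2 + 1) / 30) =
      5 * X / (6 * (k ^ 2 + 1)) := by
    field_simp
    norm_num
  rw [e _ hpos, div_le_div_iff₀ (by norm_num) (by positivity)]
  nlinarith [mul_nonneg (by linarith : (0 : ℝ) ≤ k) (by nlinarith : (0 : ℝ) ≤ (k : ℝ) ^ 2 - 4)]

theorem le_sum_jcoeff_sq {k : ℕ} (hk : 2 ≤ k) :
    (k : ℝ) / 8 ≤ ∑ n ∈ Finset.Ioo (-(k : ℤ)) k, jcoeff k n ^ 2 := by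
  have h1 := half_le_sum_jcoeff hk
  have h2 := sq_sum_le_card_mul_sum_sq (s := Finset.Ioo (-(k : ℤ)) k) (f := jcoeff k)
  have h3 := card_Ioo_le k
  have hk' : (2 : ℝ) ≤ k := by exact_mod_cast hk
  have h4 : 0 ≤ ∑ n ∈ Finset.Ioo (-(k : ℤ)) k, jcoeff k n ^ 2 :=
    Finset.sum_nonneg fun _ _ => sq_nonneg _
  have h5 : ((k : ℝ) / 2) ^ 2 ≤ 2 * k * ∑ n ∈ Finset.Ioo (-(k : ℤ)) k, jcoeff k n ^ 2 :=
    (pow_le_pow_left₀ (by positivity) h1 2).trans (h2.trans (by gcongr))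
  have h6 : (k : ℝ) * (k / 8) ≤ k * ∑ n ∈ Finset.Ioo (-(k : ℤ)) k, jcoeff k n ^ 2 := by
    nlinarith
  exact le_of_mul_le_mul_left h6 (by linarith)

theorem norm_bumpPoly_mul (k : ℕ) (u : ℝ) :
    ‖∑ j ∈ Finset.range k, ((bump k (j + 1) - bump k j : ℝ) : ℂ) * expi (j * u)‖ ^ 2 =
      ‖bumpPoly k u‖ ^ 2 * (4 * Real.sin (Real.pi * u) ^ 2) := by
  have h1 : expi u * ∑ j ∈ Finset.range k, ((bump k (j + 1) - bump k j : ℝ) : ℂ) * expi (j * u) =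
      bumpPoly k u * (1 - expi u) := by
    have h2 : ∑ j ∈ Finset.range k, (bump k (j + 1) : ℂ) * expi ((j + 1 : ℕ) * u) =
        bumpPoly k u := by
      have e1 := Finset.sum_range_succ (fun j => (bump k j : ℂ) * expi (j * u)) k
      have e2 := Finset.sum_range_succ' (fun j => (bump k j : ℂ) * expi (j * u)) k
      have e3 : bump k k = 0 := by simp [bump]
      have e4 : bump k 0 = 0 := by simp [bump]
      rw [e3] at e1
      rw [e4] at e2
      simp only [Complex.ofReal_zero, zero_mul, add_zero] at e1 e2
      rw [bumpPoly, ← e1, e2]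
    have h5 : bumpPoly k u * (1 - expi u) =
        ∑ j ∈ Finset.range k, (bump k (j + 1) : ℂ) * expi ((j + 1 : ℕ) * u) -
          expi u * ∑ j ∈ Finset.range k, (bump k j : ℂ) * expi (j * u) := by
      rw [h2, ← bumpPoly]
      ring
    rw [h5, Finset.mul_sum, Finset.mul_sum, ← Finset.sum_sub_distrib]
    refine Finset.sum_congr rfl fun j _ => ?_
    push_cast
    rw [add_mul, expi_add, one_mul]
    ring
  have h3 : ‖1 - expi u‖ ^ 2 = 4 * Real.sin (Real.pi * u) ^ 2 := by
    rw [← Complex.normSq_eq_norm_sq, Complex.normSq_apply]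
    simp only [Complex.sub_re, Complex.sub_im, Complex.one_re, Complex.one_im, re_expi, im_expi]
    have e : 2 * Real.pi * u = 2 * (Real.pi * u) := by ring
    rw [e, Real.cos_two_mul, Real.sin_two_mul]
    nlinarith [Real.sin_sq_add_cos_sq (Real.pi * u)]
  have h4 := congrArg (fun z => ‖z‖ ^ 2) h1
  simpa [norm_mul, norm_expi, mul_pow, h3] using h4

theorem integral_jker_mul_sq_le {k : ℕ} (hk : 2 ≤ k) :
    ∫ u in (-(1 / 2) : ℝ)..(1 / 2), jker k u * u ^ 2 ≤ 1 / (k : ℝ) ^ 2 := by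
  have hB := sum_bump_sq_pos hk
  have hpos := cube_sub_pos hk
  have hk' : (2 : ℝ) ≤ k := by exact_mod_cast hk
  set B := ∑ j ∈ Finset.range k, bump k j ^ 2 with hBdef
  have h1 : ∀ u ∈ Icc (-(1 / 2) : ℝ) (1 / 2), jker k u * u ^ 2 ≤
      ‖∑ j ∈ Finset.range k, ((bump k (j + 1) - bump k j : ℝ) : ℂ) * expi (j * u)‖ ^ 2 /
        (16 * B) := by
    intro u hu
    rw [norm_bumpPoly_mul]
    have h2 : 2 / Real.pi * |Real.pi * u| ≤ |Real.sin (Real.pi * u)| := by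
      refine Real.mul_abs_le_abs_sin ?_
      rw [abs_mul, abs_of_pos Real.pi_pos]
      have := abs_le.2 hu
      nlinarith [Real.pi_pos]
    have h3 : 2 / Real.pi * |Real.pi * u| = 2 * |u| := by
      rw [abs_mul, abs_of_pos Real.pi_pos]
      field_simp
    rw [h3] at h2
    have h4 : 4 * u ^ 2 ≤ Real.sin (Real.pi * u) ^ 2 := by
      rw [← sq_abs u, ← sq_abs (Real.sin _)]
      nlinarith [abs_nonneg u]
    have e : ‖bumpPoly k u‖ ^ 2 * (4 * Real.sin (Real.pi * u) ^ 2) / (16 * B) =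
        jker k u * (Real.sin (Real.pi * u) ^ 2 / 4) := by
      rw [jker, ← hBdef]
      field_simp
      ring
    rw [e]
    refine mul_le_mul_of_nonneg_left ?_ (jker_nonneg k u)
    linarith
  have hcont : Continuous fun u : ℝ =>
      ‖∑ j ∈ Finset.range k, ((bump k (j + 1) - bump k j : ℝ) : ℂ) * expi (j * u)‖ ^ 2 /
        (16 * B) := by
    have : Continuous fun u : ℝ =>
        ∑ j ∈ Finset.range k, ((bump k (j + 1) - bump k j : ℝ) : ℂ) * expi (j * u) :=
      continuous_finsetSum _ fun _ _ =>
        continuous_const.mul (continuous_expi.comp (continuous_const.mul continuous_id))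
    exact (this.norm.pow 2).div_const _
  refine (intervalIntegral.integral_mono_on (by norm_num)
    (((continuous_jker k).mul (continuous_pow 2)).intervalIntegrable _ _)
    (hcont.intervalIntegrable _ _) h1).trans ?_
  rw [intervalIntegral.integral_div, integral_norm_sq_sum_expi, sum_bump_diff_sq, hBdef,
    sum_bump_sq]
  have e (X : ℝ) (hX : 0 < X) : X / 3 / (16 * (X * ((k : ℝ) ^ 2 + 1) / 30)) =
      5 / (8 * (k ^ 2 + 1)) := by
    field_simp
    norm_num
  rw [e _ hpos, div_le_div_iff₀ (by positivity) (by positivity)]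
  nlinarith

/-- Convolution of a continuous function with the modulated kernel. -/
noncomputable def convKer (k : ℕ) (H : ℤ) (F : ℝ → ℝ) (t : ℝ) : ℂ :=
  ∫ u in (-(1 / 2) : ℝ)..(1 / 2), (jker k u : ℂ) * expi (-H * u) * (F (t + u) : ℂ)

theorem norm_convKer_le {k : ℕ} (hk : 2 ≤ k) {H : ℤ} (hH : k ≤ H) {F : ℝ → ℝ}
    (hF : Continuous F) {M c δ : ℝ} (hc : 0 ≤ c) (hδ : 0 < δ) (hM : ∀ s, |F s| ≤ M) {t t' : ℝ}
    (hloc : ∀ s, |s - t| ≤ δ → |F s - F t| ≤ c * Real.sqrt |s - t|) (ht : |t' - t| ≤ 1 / k) :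
    ‖convKer k H F t'‖ ≤ 5 * c / Real.sqrt k + 8 * M / (δ ^ 2 * k ^ 2) := by
  have hk' : (2 : ℝ) ≤ k := by exact_mod_cast hk
  have hkpos : (0 : ℝ) < k := by linarith
  have hM0 : 0 ≤ M := (abs_nonneg _).trans (hM 0)
  have hr : 0 < Real.sqrt k := Real.sqrt_pos.2 hkpos
  set A := 3 * c / Real.sqrt k + 4 * M / (δ ^ 2 * k ^ 2) with hA
  set B := 2 * c / Real.sqrt k * k ^ 2 + 4 * M / δ ^ 2 with hB
  have hglob (s : ℝ) : |F s - F t| ≤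
      c / Real.sqrt k * (1 + k ^ 2 * (s - t) ^ 2) + 2 * M / δ ^ 2 * (s - t) ^ 2 := by
    have h0 : 0 ≤ c / Real.sqrt k * (1 + k ^ 2 * (s - t) ^ 2) := by positivity
    have h1 : 0 ≤ 2 * M / δ ^ 2 * (s - t) ^ 2 := by positivity
    rcases le_total |s - t| δ with h | h
    · have h2 : Real.sqrt |s - t| ≤ 1 / Real.sqrt k * (1 + k ^ 2 * (s - t) ^ 2) := by
        rw [one_div, inv_mul_eq_div, le_div_iff₀ hr, ← Real.sqrt_mul (abs_nonneg _)]
        refine Real.sqrt_le_iff.2 ⟨by positivity, ?_⟩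
        rw [← sq_abs (s - t)]
        have : 0 ≤ |s - t| * k := by positivity
        nlinarith [sq_nonneg (|s - t| * k), sq_nonneg (|s - t| * k - 1),
          pow_nonneg this 3, pow_nonneg this 4]
      have h3 : c * Real.sqrt |s - t| ≤ c / Real.sqrt k * (1 + k ^ 2 * (s - t) ^ 2) := by
        have e : c / Real.sqrt k * (1 + k ^ 2 * (s - t) ^ 2) =
            c * (1 / Real.sqrt k * (1 + k ^ 2 * (s - t) ^ 2)) := by ring
        rw [e]
        gcongr
      linarith [hloc s h]
    · have h2 : |F s - F t| ≤ 2 * M := by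
        have := abs_sub (F s) (F t)
        linarith [hM s, hM t]
      have h3 : 2 * M ≤ 2 * M / δ ^ 2 * (s - t) ^ 2 := by
        rw [div_mul_eq_mul_div, le_div_iff₀ (by positivity), ← sq_abs (s - t)]
        gcongr
      linarith
  have hpt (u : ℝ) : |F (t' + u) - F t| ≤ A + B * u ^ 2 := by
    refine (hglob (t' + u)).trans ?_
    have h1 : (t' - t) ^ 2 ≤ 1 / k ^ 2 := by
      rw [← sq_abs, ← one_div_pow]
      exact pow_le_pow_left₀ (abs_nonneg _) ht 2
    have h2 : (t' + u - t) ^ 2 ≤ 2 * u ^ 2 + 2 * (1 / k ^ 2) := by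
      nlinarith [sq_nonneg (t' - t - u)]
    calc c / Real.sqrt k * (1 + k ^ 2 * (t' + u - t) ^ 2) + 2 * M / δ ^ 2 * (t' + u - t) ^ 2
        ≤ c / Real.sqrt k * (1 + k ^ 2 * (2 * u ^ 2 + 2 * (1 / k ^ 2))) +
          2 * M / δ ^ 2 * (2 * u ^ 2 + 2 * (1 / k ^ 2)) := by gcongr
      _ = A + B * u ^ 2 := by
          rw [hA, hB]
          field_simp
          ring
  have hcJ := continuous_jker k
  have hce : Continuous fun u : ℝ => expi (-H * u) :=
    continuous_expi.comp (continuous_const.mul continuous_id)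
  have hcJe : Continuous fun u : ℝ => (jker k u : ℂ) * expi (-H * u) :=
    (Complex.continuous_ofReal.comp hcJ).mul hce
  have hcF : Continuous fun u : ℝ => F (t' + u) := hF.comp (continuous_const.add continuous_id)
  have hzero : ∫ u in (-(1 / 2) : ℝ)..(1 / 2), (jker k u : ℂ) * expi (-H * u) * (F t : ℂ) = 0 := by
    rw [intervalIntegral.integral_mul_const]
    have := integral_jker_mul_expi k (-H)
    push_cast at this
    rw [this, jcoeff_neg, jcoeff_eq_zero (hH.trans (le_abs_self H))]
    simp
  have hsub : convKer k H F t' = ∫ u in (-(1 / 2) : ℝ)..(1 / 2),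
      (jker k u : ℂ) * expi (-H * u) * ((F (t' + u) - F t : ℝ) : ℂ) := by
    rw [← sub_zero (convKer k H F t'), ← hzero, convKer, ← intervalIntegral.integral_sub]
    · refine intervalIntegral.integral_congr fun u _ => ?_
      push_cast
      ring
    · exact (hcJe.mul (Complex.continuous_ofReal.comp hcF)).intervalIntegrable _ _
    · exact (hcJe.mul continuous_const).intervalIntegrable _ _
  rw [hsub]
  have hint1 : IntervalIntegrable (fun u => A * jker k u) volume (-(1 / 2)) (1 / 2) :=
    (continuous_const.mul hcJ).intervalIntegrable _ _
  have hint2 : IntervalIntegrable (fun u => B * (jker k u * u ^ 2)) volume (-(1 / 2)) (1 / 2) :=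
    (continuous_const.mul (hcJ.mul (continuous_pow 2))).intervalIntegrable _ _
  refine (intervalIntegral.norm_integral_le_of_norm_le (g := fun u => A * jker k u +
    B * (jker k u * u ^ 2)) (by norm_num) (ae_of_all _ fun u _ => ?_) (hint1.add hint2)).trans ?_
  · rw [norm_mul, norm_mul, norm_expi, mul_one, Complex.norm_real, Complex.norm_real,
      Real.norm_of_nonneg (jker_nonneg k u), Real.norm_eq_abs]
    calc jker k u * |F (t' + u) - F t| ≤ jker k u * (A + B * u ^ 2) :=
          mul_le_mul_of_nonneg_left (hpt u) (jker_nonneg k u)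
      _ = _ := by ring
  · rw [intervalIntegral.integral_add hint1 hint2, intervalIntegral.integral_const_mul,
      intervalIntegral.integral_const_mul, integral_jker hk, mul_one]
    have hB0 : 0 ≤ B := by positivity
    calc A + B * ∫ u in (-(1 / 2) : ℝ)..(1 / 2), jker k u * u ^ 2
        ≤ A + B * (1 / (k : ℝ) ^ 2) := by
          gcongr
          exact integral_jker_mul_sq_le hk
      _ = _ := by
          rw [hA, hB]
          field_simp
          ring

/-- The real part of the coefficient for `h ≠ 0`; it vanishes for `h = 0`. -/
noncomputable def sinCoeff (h : ℤ) (t : ℝ) : ℝ := Real.sin (2 * Real.pi * (h * t)) / (2 * Real.pi * h)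

theorem sinCoeff_zero (t : ℝ) : sinCoeff 0 t = 0 := by simp [sinCoeff]

theorem re_coeff {h : ℤ} (hh : h ≠ 0) (t : ℝ) : (coeff h t).re = sinCoeff h t := by
  have hC : (h : ℂ) ≠ 0 := by exact_mod_cast hh
  have hpi : (Real.pi : ℂ) ≠ 0 := by exact_mod_cast Real.pi_ne_zero
  have e : coeff h t = -Complex.I * (expi (h * t) - 1) / ((2 * Real.pi * h : ℝ) : ℂ) := by
    rw [coeff_of_ne_zero hh]
    push_cast
    field_simp
    rw [Complex.I_sq]
    ring
  rw [e, Complex.div_ofReal_re, sinCoeff, ← im_expi]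
  congr 1
  simp

theorem continuous_sinCoeff (h : ℤ) : Continuous (sinCoeff h) := by
  unfold sinCoeff
  fun_prop

/-- The partial sums of the odd periodic part of the real part of the path. -/
noncomputable def sinSum (x : ℤ → ℝ) (m : ℕ) (t : ℝ) : ℝ :=
  ∑ h ∈ Finset.Ioo (-(m : ℤ)) (m : ℤ), sinCoeff h t * x h

theorem continuous_sinSum (x : ℤ → ℝ) (m : ℕ) : Continuous (sinSum x m) :=
  continuous_finsetSum _ fun h _ => (continuous_sinCoeff h).mul continuous_const

theorem sinSum_neg (x : ℤ → ℝ) (m : ℕ) (t : ℝ) : sinSum x m (-t) = -sinSum x m t := by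
  rw [sinSum, sinSum, ← Finset.sum_neg_distrib]
  refine Finset.sum_congr rfl fun h _ => ?_
  rw [sinCoeff, sinCoeff, mul_neg, mul_neg, Real.sin_neg]
  ring

theorem sinSum_add_int (x : ℤ → ℝ) (m : ℕ) (t : ℝ) (n : ℤ) :
    sinSum x m (t + n) = sinSum x m t := by
  refine Finset.sum_congr rfl fun h _ => ?_
  rw [sinCoeff, sinCoeff, ← im_expi, ← im_expi, mul_add, expi_add, ← Int.cast_mul, expi_int,
    mul_one]

/-- The odd periodic part of the real part of the path. -/
noncomputable def oddPart {Ω : Type*} (ST : ℤ → Ω → ℝ) (ω : Ω) (t : ℝ) : ℝ :=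
  (K ST t ω).re - t * ST 0 ω

/-- The coefficients of the band-limited part of the path around the frequency `H`. -/
noncomputable def bandCoeff (k : ℕ) (H : ℤ) (t : ℝ) (h : ℤ) : ℂ :=
  jcoeff k (|h| - H) * expi ((|h| : ℤ) * t) / (4 * Real.pi * Complex.I * (|h| : ℤ))

/-- The frequencies `h` with `H - k < |h| < H + k`. -/
noncomputable def band (k : ℕ) (H : ℤ) : Finset ℤ := (Finset.Ioo (-(H + k)) (H + k)).filter fun h => H - k < |h|

theorem mem_band {k : ℕ} {H h : ℤ} : h ∈ band k H ↔ H - k < |h| ∧ |h| < H + k := by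
  rw [band, Finset.mem_filter, Finset.mem_Ioo, abs_lt]
  tauto

theorem bandCoeff_eq_zero {k : ℕ} {H h : ℤ} (hh : h ∉ band k H) (t : ℝ) : bandCoeff k H t h = 0 := by
  rw [bandCoeff, jcoeff_eq_zero]
  · simp
  · rw [mem_band, not_and_or, not_lt, not_lt] at hh
    rcases hh with h1 | h1
    · rw [abs_sub_comm]
      refine le_trans ?_ (le_abs_self _)
      omega
    · refine le_trans ?_ (le_abs_self _)
      omega

theorem convKer_sinCoeff {k : ℕ} {H : ℤ} (hH : k ≤ H) (h : ℤ) (t : ℝ) :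
    convKer k H (sinCoeff h) t = bandCoeff k H t h := by
  by_cases hh : h = 0
  · subst hh
    simp [convKer, sinCoeff_zero, bandCoeff]
  have hC : (h : ℂ) ≠ 0 := by exact_mod_cast hh
  have hpi : (Real.pi : ℂ) ≠ 0 := by exact_mod_cast Real.pi_ne_zero
  have hsin (x : ℝ) : ((sinCoeff h x : ℝ) : ℂ) =
      (expi (h * x) - expi (-h * x)) / (4 * Real.pi * Complex.I * h) := by
    rw [sinCoeff, neg_mul, ← conj_expi, Complex.sub_conj, im_expi]
    push_cast
    field_simp
    ring
  have h1 (u : ℝ) : (jker k u : ℂ) * expi (-H * u) * (sinCoeff h (t + u) : ℂ) =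
      expi (h * t) / (4 * Real.pi * Complex.I * h) * ((jker k u : ℂ) * expi ((h - H : ℤ) * u)) -
      expi (-h * t) / (4 * Real.pi * Complex.I * h) *
        ((jker k u : ℂ) * expi ((-h - H : ℤ) * u)) := by
    have e1 : expi ((h - H : ℤ) * u) = expi (-H * u) * expi (h * u) := by
      rw [← expi_add]
      push_cast
      ring_nf
    have e2 : expi ((-h - H : ℤ) * u) = expi (-H * u) * expi (-h * u) := by
      rw [← expi_add]
      push_cast
      ring_nf
    rw [hsin, e1, e2, mul_add, mul_add, expi_add, expi_add]
    ring
  have hint (n : ℤ) (c : ℂ) : IntervalIntegrable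
      (fun u : ℝ => c * ((jker k u : ℂ) * expi (n * u))) volume (-(1 / 2)) (1 / 2) :=
    (continuous_const.mul ((Complex.continuous_ofReal.comp (continuous_jker k)).mul
      (continuous_expi.comp (continuous_const.mul continuous_id)))).intervalIntegrable _ _
  rw [convKer]
  simp_rw [h1]
  rw [intervalIntegral.integral_sub (hint _ _) (hint _ _), intervalIntegral.integral_const_mul,
    intervalIntegral.integral_const_mul, integral_jker_mul_expi, integral_jker_mul_expi, bandCoeff]
  rcases lt_or_gt_of_ne hh with hneg | hpos
  · have e1 : jcoeff k (h - H) = 0 := by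
      refine jcoeff_eq_zero (le_trans ?_ (neg_le_abs _))
      omega
    rw [e1, abs_of_neg hneg]
    push_cast
    field_simp
    ring
  · have e1 : jcoeff k (-h - H) = 0 := by
      refine jcoeff_eq_zero (le_trans ?_ (neg_le_abs _))
      omega
    rw [e1, abs_of_pos hpos]
    push_cast
    ring

theorem convKer_sinSum {k m : ℕ} {H : ℤ} (hH : k ≤ H) (hm : H + k ≤ m) (x : ℤ → ℝ) (t : ℝ) :
    convKer k H (sinSum x m) t = ∑ h ∈ band k H, bandCoeff k H t h * (x h : ℂ) := by
  have h1 (u : ℝ) : (jker k u : ℂ) * expi (-H * u) * (sinSum x m (t + u) : ℂ) =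
      ∑ h ∈ Finset.Ioo (-(m : ℤ)) (m : ℤ),
        (jker k u : ℂ) * expi (-H * u) * (sinCoeff h (t + u) : ℂ) * (x h : ℂ) := by
    rw [sinSum, Complex.ofReal_sum, Finset.mul_sum]
    refine Finset.sum_congr rfl fun h _ => ?_
    push_cast
    ring
  rw [convKer]
  simp_rw [h1]
  rw [intervalIntegral.integral_finsetSum]
  · have h2 : ∀ h ∈ Finset.Ioo (-(m : ℤ)) (m : ℤ), ∫ u in (-(1 / 2) : ℝ)..(1 / 2),
        (jker k u : ℂ) * expi (-H * u) * (sinCoeff h (t + u) : ℂ) * (x h : ℂ) =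
        bandCoeff k H t h * (x h : ℂ) := by
      intro h _
      rw [intervalIntegral.integral_mul_const, ← convKer_sinCoeff hH, convKer]
    rw [Finset.sum_congr rfl h2]
    symm
    refine Finset.sum_subset (fun h hh => ?_) fun h _ hh => ?_
    · rw [mem_band, abs_lt] at hh
      rw [Finset.mem_Ioo]
      omega
    · rw [bandCoeff_eq_zero hh, zero_mul]
  · intro h _
    refine Continuous.intervalIntegrable ?_ _ _
    exact (((Complex.continuous_ofReal.comp (continuous_jker k)).mul
      (continuous_expi.comp (continuous_const.mul continuous_id))).mul
      (Complex.continuous_ofReal.comp ((continuous_sinCoeff h).comp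
        (continuous_const.add continuous_id)))).mul continuous_const

theorem norm_convKer_sub_le {k : ℕ} (hk : 2 ≤ k) (H : ℤ) {F G : ℝ → ℝ} (hF : Continuous F)
    (hG : Continuous G) {B : ℝ} (hB : ∀ s, |F s - G s| ≤ B) (t : ℝ) :
    ‖convKer k H F t - convKer k H G t‖ ≤ B := by
  have hc (F : ℝ → ℝ) (hF : Continuous F) : IntervalIntegrable
      (fun u : ℝ => (jker k u : ℂ) * expi (-H * u) * (F (t + u) : ℂ)) volume
      (-(1 / 2)) (1 / 2) :=
    (((Complex.continuous_ofReal.comp (continuous_jker k)).mul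
      (continuous_expi.comp (continuous_const.mul continuous_id))).mul
      (Complex.continuous_ofReal.comp
        (hF.comp (continuous_const.add continuous_id)))).intervalIntegrable _ _
  rw [convKer, convKer, ← intervalIntegral.integral_sub (hc F hF) (hc G hG)]
  refine (intervalIntegral.norm_integral_le_of_norm_le (g := fun u => jker k u * B) (by norm_num)
    (ae_of_all _ fun u _ => ?_)
    (((continuous_jker k).mul continuous_const).intervalIntegrable _ _)).trans ?_
  · rw [← mul_sub, norm_mul, norm_mul, norm_expi, mul_one, Complex.norm_real,
      Real.norm_of_nonneg (jker_nonneg k u), ← Complex.ofReal_sub, Complex.norm_real]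
    exact mul_le_mul_of_nonneg_left (hB _) (jker_nonneg k u)
  · rw [intervalIntegral.integral_mul_const, integral_jker hk, one_mul]

section Path

variable {Ω : Type*} {ST : ℤ → Ω → ℝ} {ω : Ω}

theorem re_partialSum {m : ℕ} (hm : 1 ≤ m) (t : ℝ) :
    (partialSum ST m t ω).re = sinSum (fun h => ST h ω) m t + t * ST 0 ω := by
  have h0 : (0 : ℤ) ∈ Finset.Ioo (-(m : ℤ)) (m : ℤ) := by
    rw [Finset.mem_Ioo]
    omega
  rw [partialSum, sinSum, Complex.re_sum, ← Finset.add_sum_erase _ _ h0,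
    ← Finset.add_sum_erase _ _ h0, sinCoeff_zero]
  have e : (coeff 0 t * (ST 0 ω : ℂ)).re = t * ST 0 ω := by simp [coeff]
  rw [e, zero_mul, zero_add, add_comm]
  congr 1
  refine Finset.sum_congr rfl fun h hh => ?_
  rw [Complex.re_mul_ofReal, re_coeff (Finset.ne_of_mem_erase hh)]

namespace IsRegularPath

theorem exists_abs_oddPart_sub_le (h : IsRegularPath ST ω) : ∃ C, 0 < C ∧ ∀ m : ℕ, 1 ≤ m → ∀ t,
    |oddPart ST ω t - sinSum (fun h => ST h ω) m t| ≤ C * (m : ℝ) ^ ((3 / 4 : ℝ) - 1) := by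
  obtain ⟨C, hC, H, -⟩ := h (3 / 4) (by norm_num) (by norm_num)
  refine ⟨C, hC, fun m hm t => ?_⟩
  have e : oddPart ST ω t - sinSum (fun h => ST h ω) m t =
      (K ST t ω - partialSum ST m t ω).re := by
    rw [Complex.sub_re, re_partialSum hm, oddPart]
    ring
  rw [e]
  exact (Complex.abs_re_le_norm _).trans (H m hm t)

theorem continuous_oddPart (h : IsRegularPath ST ω) : Continuous (oddPart ST ω) :=
  (Complex.continuous_re.comp h.continuous).sub (continuous_id.mul continuous_const)

theorem tendsto_sinSum (h : IsRegularPath ST ω) (t : ℝ) :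
    Tendsto (fun m => sinSum (fun h => ST h ω) m t) atTop (𝓝 (oddPart ST ω t)) := by
  obtain ⟨C, -, H⟩ := h.exists_abs_oddPart_sub_le
  rw [tendsto_iff_norm_sub_tendsto_zero]
  refine squeeze_zero' (Eventually.of_forall fun _ => norm_nonneg _) ?_
    (tendsto_natCast_rpow_sub_one (by norm_num : (3 / 4 : ℝ) < 1) C)
  filter_upwards [eventually_ge_atTop 1] with m hm
  rw [norm_sub_rev]
  exact H m hm t

theorem oddPart_neg (h : IsRegularPath ST ω) (t : ℝ) : oddPart ST ω (-t) = -oddPart ST ω t := by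
  refine tendsto_nhds_unique (h.tendsto_sinSum (-t)) ?_
  simp_rw [sinSum_neg]
  exact (h.tendsto_sinSum t).neg

theorem oddPart_add_int (h : IsRegularPath ST ω) (t : ℝ) (n : ℤ) :
    oddPart ST ω (t + n) = oddPart ST ω t := by
  refine tendsto_nhds_unique (h.tendsto_sinSum (t + n)) ?_
  simp_rw [sinSum_add_int]
  exact h.tendsto_sinSum t

theorem exists_abs_oddPart_le (h : IsRegularPath ST ω) : ∃ M, ∀ t, |oddPart ST ω t| ≤ M := by
  obtain ⟨C, -, H⟩ := h.exists_abs_oddPart_sub_le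
  refine ⟨C, fun t => ?_⟩
  have := H 1 le_rfl t
  rw [sinSum, sum_Ioo_one, sinCoeff_zero] at this
  simpa using this

theorem convKer_oddPart (h : IsRegularPath ST ω) {k : ℕ} (hk : 2 ≤ k) {H : ℤ} (hH : k ≤ H)
    (t : ℝ) : convKer k H (oddPart ST ω) t = ∑ h ∈ band k H, bandCoeff k H t h * (ST h ω : ℂ) := by
  obtain ⟨C, -, HC⟩ := h.exists_abs_oddPart_sub_le
  have h1 : ‖convKer k H (oddPart ST ω) t - ∑ h ∈ band k H, bandCoeff k H t h * (ST h ω : ℂ)‖ ≤ 0 := by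
    refine ge_of_tendsto (tendsto_natCast_rpow_sub_one (by norm_num : (3 / 4 : ℝ) < 1) C) ?_
    filter_upwards [eventually_ge_atTop 1, eventually_ge_atTop (H + k).toNat] with m hm1 hm2
    rw [← convKer_sinSum hH (by omega : H + k ≤ m) (fun h => ST h ω) t]
    exact norm_convKer_sub_le hk H h.continuous_oddPart (continuous_sinSum _ _) (HC m hm1) t
  exact sub_eq_zero.1 (norm_le_zero_iff.1 h1)

/-- A one-sided square root bound at an end point becomes two-sided, by oddness. -/
theorem exists_oddPart_sub_le (h : IsRegularPath ST ω) {t c δ : ℝ} (ht : t ∈ Icc (0 : ℝ) 1)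
    (hc : 0 < c) (hδ : 0 < δ)
    (hK : ∀ s ∈ Icc (0 : ℝ) 1, |s - t| ≤ δ → ‖K ST s ω - K ST t ω‖ ≤ c * Real.sqrt |s - t|) :
    ∃ ε, 0 < ε ∧ ∀ s, |s - t| ≤ ε →
      |oddPart ST ω s - oddPart ST ω t| ≤ 2 * c * Real.sqrt |s - t| := by
  set b := |ST 0 ω| + 1 with hb
  have hbpos : 0 < b := by positivity
  set ε₀ := min δ ((c / b) ^ 2) with hε₀
  have hε₀pos : 0 < ε₀ := by positivity
  have hin : ∀ s ∈ Icc (0 : ℝ) 1, |s - t| ≤ ε₀ →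
      |oddPart ST ω s - oddPart ST ω t| ≤ 2 * c * Real.sqrt |s - t| := by
    intro s hs hst
    have h1 := hK s hs (hst.trans (min_le_left _ _))
    have h2 : |s - t| * b ≤ c * Real.sqrt |s - t| := by
      have h3 : Real.sqrt |s - t| ≤ c / b := by
        rw [Real.sqrt_le_left (by positivity)]
        exact hst.trans (min_le_right _ _)
      rw [le_div_iff₀ hbpos] at h3
      have h4 := Real.mul_self_sqrt (abs_nonneg (s - t))
      nlinarith [Real.sqrt_nonneg |s - t|]
    have e : oddPart ST ω s - oddPart ST ω t =
        (K ST s ω - K ST t ω).re - (s - t) * ST 0 ω := by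
      rw [oddPart, oddPart, Complex.sub_re]
      ring
    rw [e]
    refine (abs_sub _ _).trans ?_
    rw [abs_mul]
    have h5 := Complex.abs_re_le_norm (K ST s ω - K ST t ω)
    have h6 : |s - t| * |ST 0 ω| ≤ |s - t| * b := by gcongr; linarith
    linarith
  have hzero : oddPart ST ω 0 = 0 := by
    have := h.oddPart_neg 0
    rw [neg_zero] at this
    linarith
  rcases eq_or_lt_of_le ht.1 with rfl | ht0
  · refine ⟨min ε₀ 1, by positivity, fun s hs => ?_⟩
    have hs1 := (abs_le.1 (hs.trans (min_le_right _ _)))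
    rcases le_total 0 s with h0 | h0
    · exact hin s ⟨h0, by linarith [hs1.2]⟩ (hs.trans (min_le_left _ _))
    · have h1 := hin (-s) ⟨by linarith, by linarith [hs1.1]⟩ (by
        rw [sub_zero, abs_neg]
        simpa using hs.trans (min_le_left _ _))
      rw [h.oddPart_neg, hzero, sub_zero, sub_zero, abs_neg, abs_neg] at h1
      rwa [hzero, sub_zero, sub_zero]
  rcases eq_or_lt_of_le ht.2 with rfl | ht1
  · have hone : oddPart ST ω 1 = 0 := by
      have := h.oddPart_add_int 0 1
      rw [hzero] at this
      simpa using this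
    refine ⟨min ε₀ 1, by positivity, fun s hs => ?_⟩
    have hs1 := (abs_le.1 (hs.trans (min_le_right _ _)))
    rcases le_total s 1 with h0 | h0
    · exact hin s ⟨by linarith [hs1.1], h0⟩ (hs.trans (min_le_left _ _))
    · have e1 : 2 - s - 1 = -(s - 1) := by ring
      have h1 := hin (2 - s) ⟨by linarith [hs1.2], by linarith⟩ (by
        rw [e1, abs_neg]
        exact hs.trans (min_le_left _ _))
      have e2 : oddPart ST ω (2 - s) = -oddPart ST ω s := by
        rw [← h.oddPart_neg, ← h.oddPart_add_int (-s) 2]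
        congr 1
        push_cast
        ring
      rw [e1, abs_neg, e2, hone, sub_zero, abs_neg] at h1
      rwa [hone, sub_zero]
  · refine ⟨min ε₀ (min t (1 - t)), by
      have : 0 < 1 - t := by linarith
      positivity, fun s hs => ?_⟩
    have h1 := abs_le.1 (hs.trans ((min_le_right _ _).trans (min_le_left _ _)))
    have h2 := abs_le.1 (hs.trans ((min_le_right _ _).trans (min_le_right _ _)))
    exact hin s ⟨by linarith [h1.1], by linarith [h2.2]⟩ (hs.trans (min_le_left _ _))

/-- A square root bound for the increments at `t` bounds the band-limited parts near `t`. -/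
theorem exists_norm_band_sum_le (h : IsRegularPath ST ω) {t c δ : ℝ} (ht : t ∈ Icc (0 : ℝ) 1)
    (hc : 0 < c) (hδ : 0 < δ)
    (hK : ∀ s ∈ Icc (0 : ℝ) 1, |s - t| ≤ δ → ‖K ST s ω - K ST t ω‖ ≤ c * Real.sqrt |s - t|) :
    ∃ D : ℝ, ∀ (k : ℕ) (H : ℤ) (t' : ℝ), 2 ≤ k → k ≤ H → |t' - t| ≤ 1 / k →
      ‖∑ h ∈ band k H, bandCoeff k H t' h * (ST h ω : ℂ)‖ ≤
        10 * c / Real.sqrt k + D / (k : ℝ) ^ 2 := by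
  obtain ⟨ε, hε, hloc⟩ := h.exists_oddPart_sub_le ht hc hδ hK
  obtain ⟨M, hM⟩ := h.exists_abs_oddPart_le
  refine ⟨8 * M / ε ^ 2, fun k H t' hk hH ht' => ?_⟩
  rw [← h.convKer_oddPart hk hH]
  refine (norm_convKer_le hk hH h.continuous_oddPart (by positivity) hε hM hloc ht').trans
    (le_of_eq ?_)
  rw [div_div]
  ring

end IsRegularPath

end Path

theorem norm_bandCoeff_le {k : ℕ} (hk : 2 ≤ k) {H h : ℤ} (hH : 2 * k ≤ H) (hh : h ∈ band k H)
    (t : ℝ) : ‖bandCoeff k H t h‖ ≤ 1 / k := by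
  have hk' : (2 : ℝ) ≤ k := by exact_mod_cast hk
  rw [mem_band] at hh
  have h1 : (k : ℝ) ≤ (|h| : ℤ) := by
    have : (k : ℤ) ≤ |h| := by omega
    exact_mod_cast this
  have h2 : ‖(4 * Real.pi * Complex.I * (|h| : ℤ) : ℂ)‖ = 4 * Real.pi * ((|h| : ℤ) : ℝ) := by
    simp [abs_of_pos Real.pi_pos]
  rw [bandCoeff, norm_div, norm_mul, norm_expi, mul_one, Complex.norm_real, h2]
  have h3 := abs_jcoeff_le_one hk (|h| - H)
  gcongr
  · exact h3
  · nlinarith [Real.pi_gt_three]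

theorem le_sum_norm_bandCoeff_sq {k : ℕ} (hk : 2 ≤ k) {H : ℤ} (hH : k ≤ H) (t : ℝ) :
    (k : ℝ) / (1600 * (H + k) ^ 2) ≤ ∑ h ∈ band k H, ‖bandCoeff k H t h‖ ^ 2 := by
  have hk' : (2 : ℝ) ≤ k := by exact_mod_cast hk
  have hH' : (k : ℝ) ≤ H := by exact_mod_cast hH
  have hpi := Real.pi_pos
  have h1 : ∑ n ∈ Finset.Ioo (-(k : ℤ)) k, jcoeff k n ^ 2 / (4 * Real.pi * (H + k)) ^ 2 ≤
      ∑ h ∈ band k H, ‖bandCoeff k H t h‖ ^ 2 := by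
    calc ∑ n ∈ Finset.Ioo (-(k : ℤ)) k, jcoeff k n ^ 2 / (4 * Real.pi * (H + k)) ^ 2
        ≤ ∑ n ∈ Finset.Ioo (-(k : ℤ)) k, ‖bandCoeff k H t (n + H)‖ ^ 2 := by
          refine Finset.sum_le_sum fun n hn => ?_
          rw [Finset.mem_Ioo] at hn
          have hpos : 0 < n + H := by omega
          have hposR : (0 : ℝ) < ((n + H : ℤ) : ℝ) := by exact_mod_cast hpos
          have hle : ((n + H : ℤ) : ℝ) ≤ H + k := by
            have : n + H ≤ H + k := by omega
            exact_mod_cast this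
          have h2 : ‖(4 * Real.pi * Complex.I * (n + H : ℤ) : ℂ)‖ =
              4 * Real.pi * ((n + H : ℤ) : ℝ) := by
            rw [norm_mul, Complex.norm_intCast, abs_of_pos hposR]
            simp [abs_of_pos Real.pi_pos]
          rw [bandCoeff, abs_of_pos hpos, norm_div, norm_mul, norm_expi, mul_one,
            Complex.norm_real, h2, add_sub_cancel_right, div_pow, Real.norm_eq_abs, sq_abs]
          gcongr
      _ = ∑ h ∈ (Finset.Ioo (-(k : ℤ)) k).map (addRightEmbedding H),
            ‖bandCoeff k H t h‖ ^ 2 := by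
          rw [Finset.sum_map]
          rfl
      _ ≤ _ := by
          refine Finset.sum_le_sum_of_subset_of_nonneg (fun h hh => ?_) fun _ _ _ => sq_nonneg _
          rw [Finset.mem_map] at hh
          obtain ⟨n, hn, rfl⟩ := hh
          rw [Finset.mem_Ioo] at hn
          change n + H ∈ band k H
          rw [mem_band, abs_of_pos (by omega)]
          omega
  refine le_trans ?_ h1
  rw [← Finset.sum_div]
  refine le_trans ?_ (div_le_div_of_nonneg_right (le_sum_jcoeff_sq hk) (by positivity))
  have hHk : (0 : ℝ) < (H : ℝ) + k := by linarith
  rw [div_div, div_le_div_iff₀ (by positivity) (by positivity)]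
  have hpi2 : Real.pi ^ 2 ≤ 10 := by nlinarith [Real.pi_lt_d2]
  have : 8 * (4 * Real.pi * (H + k)) ^ 2 = 128 * Real.pi ^ 2 * ((H : ℝ) + k) ^ 2 := by ring
  rw [this]
  have h5 : 128 * Real.pi ^ 2 * ((H : ℝ) + k) ^ 2 ≤ 1600 * (H + k) ^ 2 := by
    gcongr
    linarith
  gcongr

/-- The scale of the band-limited parts of width `k` with frequencies below `2 M k`. -/
noncomputable def bandScale (M k : ℕ) : ℝ := 1 / (40 * (2 * M + 1) * Real.sqrt k)

/-- The event that the band-limited part of level `n` and index `j` is small at `t`. -/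
def IsSmallBand {Ω : Type*} (ST : ℤ → Ω → ℝ) (A : ℝ) (M : ℕ) (t : ℝ) (ω : Ω) (n j : ℕ) : Prop :=
  ‖∑ h ∈ band ((2 * M + 1) ^ n) (2 * (j + 1) * (2 * M + 1) ^ n),
    bandCoeff ((2 * M + 1) ^ n) (2 * (j + 1) * (2 * M + 1) ^ n) t h * (ST h ω : ℂ)‖ <
    A * bandScale M ((2 * M + 1) ^ n)

theorem disjoint_band_of_lt {M n n' j j' : ℕ} (hj : j < M) (hn : n < n') :
    Disjoint (band ((2 * M + 1) ^ n) (2 * (j + 1) * (2 * M + 1) ^ n))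
      (band ((2 * M + 1) ^ n') (2 * (j' + 1) * (2 * M + 1) ^ n')) := by
  rw [Finset.disjoint_left]
  intro h h1 h2
  rw [mem_band] at h1 h2
  have h3 : ((2 * M + 1 : ℤ)) ^ (n + 1) ≤ (2 * M + 1) ^ n' :=
    pow_le_pow_right₀ (by omega) (by omega)
  have h4 : (0 : ℤ) < (2 * M + 1) ^ n := by positivity
  have h5 : (0 : ℤ) < (2 * M + 1) ^ n' := by positivity
  have hj' : (j : ℤ) + 1 ≤ M := by omega
  push_cast at h1 h2
  rw [pow_succ] at h3
  nlinarith [h1.2, h2.1, mul_nonneg (by omega : (0 : ℤ) ≤ (M : ℤ) - (j + 1)) h4.le,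
    mul_nonneg (by omega : (0 : ℤ) ≤ (j' : ℤ)) h5.le]

theorem disjoint_band_of_index_lt {M n j j' : ℕ} (hj : j < j') :
    Disjoint (band ((2 * M + 1) ^ n) (2 * (j + 1) * (2 * M + 1) ^ n))
      (band ((2 * M + 1) ^ n) (2 * (j' + 1) * (2 * M + 1) ^ n)) := by
  rw [Finset.disjoint_left]
  intro h h1 h2
  rw [mem_band] at h1 h2
  have h4 : (0 : ℤ) < (2 * M + 1) ^ n := by positivity
  push_cast at h1 h2
  nlinarith [h1.2, h2.1, mul_nonneg (by omega : (0 : ℤ) ≤ (j' : ℤ) - (j + 1)) h4.le]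

theorem disjoint_band {M : ℕ} {x y : ℕ × ℕ} (hx : x.2 < M) (hy : y.2 < M) (hxy : x ≠ y) :
    Disjoint (band ((2 * M + 1) ^ x.1) (2 * (x.2 + 1) * (2 * M + 1) ^ x.1))
      (band ((2 * M + 1) ^ y.1) (2 * (y.2 + 1) * (2 * M + 1) ^ y.1)) := by
  rcases lt_trichotomy x.1 y.1 with h | h | h
  · exact disjoint_band_of_lt hx h
  · rw [h]
    rcases lt_trichotomy x.2 y.2 with h' | h' | h'
    · exact disjoint_band_of_index_lt h'
    · exact absurd (Prod.ext h h') hxy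
    · exact (disjoint_band_of_index_lt h').symm
  · exact (disjoint_band_of_lt hy h).symm

section Path

variable {Ω : Type*} {ST : ℤ → Ω → ℝ} {ω : Ω}

/-- The hypothesis that the increments at `t` are bounded by `c |s - t|^{1/2}` near `t`. -/
def HasSqrtBound (ST : ℤ → Ω → ℝ) (ω : Ω) (t c δ : ℝ) : Prop :=
  ∀ s ∈ Icc (0 : ℝ) 1, |s - t| ≤ δ → ‖K ST s ω - K ST t ω‖ ≤ c * Real.sqrt |s - t|

theorem exists_forall_isSmallBand (h : IsRegularPath ST ω) {t c δ : ℝ}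
    (ht : t ∈ Icc (0 : ℝ) 1) (hc : 0 < c) (hδ : 0 < δ) (hK : HasSqrtBound ST ω t c δ)
    {A : ℝ} {M : ℕ} (hM : 1 ≤ M) (hA : 10 * c * (40 * (2 * M + 1)) < A) :
    ∃ N : ℕ, ∀ n, N ≤ n → ∀ (j : ℕ) (t' : ℝ), |t' - t| ≤ 1 / ((2 * M + 1 : ℕ) : ℝ) ^ n →
      IsSmallBand ST A M t' ω n j := by
  obtain ⟨D, hD⟩ := h.exists_norm_band_sum_le ht hc hδ hK
  set R : ℝ := 40 * (2 * M + 1) with hR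
  have hRpos : 0 < R := by positivity
  set e := A / R - 10 * c with he
  have hepos : 0 < e := by
    rw [he, sub_pos, lt_div_iff₀ hRpos]
    exact hA
  obtain ⟨N, hN⟩ := exists_nat_gt (|D| / e)
  refine ⟨N + 1, fun n hn j t' ht' => ?_⟩
  set k := (2 * M + 1) ^ n with hk
  have hkn : n < k := Nat.lt_pow_self (by omega)
  have hk2 : 2 ≤ k := by omega
  have hk2' : (2 : ℝ) ≤ k := by exact_mod_cast hk2
  have hkpos : (0 : ℝ) < k := by linarith
  have hr : 0 < Real.sqrt k := Real.sqrt_pos.2 hkpos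
  have h1 := hD k (2 * (j + 1) * (2 * M + 1) ^ n) t' hk2 (by
    have hpos : (0 : ℤ) < (2 * M + 1) ^ n := by positivity
    rw [hk]
    push_cast
    nlinarith [mul_nonneg (by omega : (0 : ℤ) ≤ (j : ℤ)) hpos.le]) (by
    rw [hk]
    push_cast at ht' ⊢
    exact ht')
  refine lt_of_le_of_lt h1 ?_
  have h2 : D / (k : ℝ) ^ 2 < e / Real.sqrt k := by
    have h3 : |D| < e * k := by
      rw [div_lt_iff₀ hepos] at hN
      have : (N : ℝ) ≤ k := by exact_mod_cast (by omega : N ≤ k)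
      nlinarith
    have h4 : Real.sqrt k ≤ k := by
      rw [Real.sqrt_le_left (by linarith)]
      nlinarith
    rw [div_lt_div_iff₀ (by positivity) hr]
    calc D * Real.sqrt k ≤ |D| * Real.sqrt k := by gcongr; exact le_abs_self D
      _ ≤ |D| * k := by gcongr
      _ < e * k * k := by gcongr
      _ = e * (k : ℝ) ^ 2 := by ring
  calc 10 * c / Real.sqrt k + D / (k : ℝ) ^ 2 < 10 * c / Real.sqrt k + e / Real.sqrt k := by
        gcongr
    _ = A * bandScale M k := by
        rw [he, bandScale, ← hR]
        field_simp
        ring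

theorem exists_hasSqrtBound_of_isLittleO {t : ℝ}
    (h : (fun s => K ST s ω - K ST t ω) =o[𝓝[Icc 0 1] t] fun s => |s - t| ^ (1 / 2 : ℝ)) {c : ℝ}
    (hc : 0 < c) : ∃ δ, 0 < δ ∧ HasSqrtBound ST ω t c δ := by
  have h1 := h.def hc
  rw [eventually_iff, Metric.mem_nhdsWithin_iff] at h1
  obtain ⟨ε, hε, hsub⟩ := h1
  refine ⟨ε / 2, by positivity, fun s hs hst => ?_⟩
  have h2 := hsub ⟨by rw [Metric.mem_ball, Real.dist_eq]; linarith, hs⟩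
  rw [mem_ofPred_eq, Real.norm_of_nonneg (by positivity), ← Real.sqrt_eq_rpow] at h2
  exact h2

theorem isLittleO_of_differentiableWithinAt {t : ℝ}
    (h : DifferentiableWithinAt ℝ (fun s => K ST s ω) (Icc 0 1) t) :
    (fun s => K ST s ω - K ST t ω) =o[𝓝[Icc 0 1] t] fun s => |s - t| ^ (1 / 2 : ℝ) := by
  refine h.isBigO_sub.trans_isLittleO ?_
  rw [Asymptotics.isLittleO_iff]
  intro c hc
  refine mem_nhdsWithin_of_mem_nhds ?_
  filter_upwards [Metric.ball_mem_nhds t (by positivity : 0 < c ^ 2)] with s hs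
  rw [Metric.mem_ball, Real.dist_eq] at hs
  rw [← Real.sqrt_eq_rpow, Real.norm_of_nonneg (Real.sqrt_nonneg _), Real.norm_eq_abs]
  have h1 : Real.sqrt |s - t| ≤ c := by
    rw [Real.sqrt_le_left hc.le]
    exact hs.le
  have h2 := Real.mul_self_sqrt (abs_nonneg (s - t))
  nlinarith [Real.sqrt_nonneg |s - t|]

theorem exists_hasSqrtBound_of_holderOnWith {a b q : ℝ} (hq : q ∈ Ioo a b) {c : ℝ≥0}
    (h : HolderOnWith c (1 / 2) (fun t => K ST t ω) (Icc a b)) :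
    ∃ c' δ, 0 < c' ∧ 0 < δ ∧ HasSqrtBound ST ω q c' δ := by
  refine ⟨c + 1, min (q - a) (b - q), by positivity,
    lt_min (by linarith [hq.1]) (by linarith [hq.2]), fun s _ hst => ?_⟩
  have h1 := abs_le.1 (hst.trans (min_le_left _ _))
  have h2 := abs_le.1 (hst.trans (min_le_right _ _))
  have h3 := h.dist_le (x := s) (y := q) ⟨by linarith [h1.1], by linarith [h2.2]⟩
    ⟨hq.1.le, hq.2.le⟩
  rw [dist_eq_norm, Real.dist_eq] at h3
  have e : (((1 / 2 : ℝ≥0)) : ℝ) = 1 / 2 := by norm_num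
  rw [e, ← Real.sqrt_eq_rpow] at h3
  refine h3.trans ?_
  gcongr
  linarith

end Path

namespace IsSatoTateSequence

variable {Ω : Type*} [MeasurableSpace Ω] {P : Measure Ω} [IsProbabilityMeasure P] {ST : ℤ → Ω → ℝ}

theorem exists_measureReal_norm_band_lt_le (hST : IsSatoTateSequence P ST) (A : ℝ) :
    ∃ p, 0 < p ∧ p ≤ 1 ∧ ∀ M : ℕ, ∃ k₀ : ℕ, ∀ (k : ℕ) (H : ℤ) (t : ℝ), k₀ ≤ k → 2 * k ≤ H →
      H ≤ 2 * M * k → P.real {ω | ‖∑ h ∈ band k H, bandCoeff k H t h * (ST h ω : ℂ)‖ <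
        A * bandScale M k} ≤ 1 - p := by
  obtain ⟨p, hp, η, hη, hprob⟩ := hST.exists_le_measureReal_norm_sum_ge A
  refine ⟨min p 1, by positivity, min_le_right _ _, fun M =>
    ⟨⌈(40 * (2 * M + 1) / η) ^ 2⌉₊ + 2, fun k H t hk hH1 hH2 => ?_⟩⟩
  have hk2 : 2 ≤ k := by omega
  have hk2' : (2 : ℝ) ≤ k := by exact_mod_cast hk2
  have hkpos : (0 : ℝ) < k := by linarith
  have hr : 0 < Real.sqrt k := Real.sqrt_pos.2 hkpos
  have hH1' : 2 * (k : ℝ) ≤ H := by exact_mod_cast hH1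
  have hH2' : (H : ℝ) ≤ 2 * M * k := by exact_mod_cast hH2
  have hσ : 0 < bandScale M k := by unfold bandScale; positivity
  have hlow : bandScale M k ^ 2 ≤ ∑ h ∈ band k H, ‖bandCoeff k H t h‖ ^ 2 := by
    refine le_trans ?_ (le_sum_norm_bandCoeff_sq hk2 (by omega) t)
    have hHk : (0 : ℝ) < H + k := by linarith
    rw [bandScale, div_pow, mul_pow, mul_pow, Real.sq_sqrt hkpos.le,
      div_le_div_iff₀ (by positivity) (by positivity)]
    have h1 : ((H : ℝ) + k) ^ 2 ≤ ((2 * M + 1) * k) ^ 2 := by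
      gcongr
      linarith
    nlinarith
  have hup : ∀ h ∈ band k H, ‖bandCoeff k H t h‖ ≤ η * bandScale M k := by
    intro h hh
    refine (norm_bandCoeff_le hk2 hH1 hh t).trans ?_
    have h1 : 40 * (2 * M + 1) / η ≤ Real.sqrt k := by
      refine Real.le_sqrt_of_sq_le ((Nat.le_ceil _).trans ?_)
      exact_mod_cast (by omega : ⌈(40 * (2 * M + 1) / η) ^ 2⌉₊ ≤ k)
    rw [div_le_iff₀ hη] at h1
    rw [bandScale, mul_one_div, div_le_div_iff₀ hkpos (by positivity), one_mul]
    calc 40 * (2 * M + 1) * Real.sqrt k ≤ Real.sqrt k * η * Real.sqrt k := by gcongr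
      _ = η * (Real.sqrt k * Real.sqrt k) := by ring
      _ = η * k := by rw [Real.mul_self_sqrt hkpos.le]
  have h1 := hprob (band k H) (bandCoeff k H t) (bandScale M k) hσ hlow hup
  have hmeas : MeasurableSet {ω | A * bandScale M k ≤
      ‖∑ h ∈ band k H, bandCoeff k H t h * (ST h ω : ℂ)‖} :=
    measurableSet_le measurable_const (hST.measurable_sum _ _).norm
  have h2 := probReal_compl_eq_one_sub (μ := P) hmeas
  have e : {ω | ‖∑ h ∈ band k H, bandCoeff k H t h * (ST h ω : ℂ)‖ < A * bandScale M k} =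
      {ω | A * bandScale M k ≤ ‖∑ h ∈ band k H, bandCoeff k H t h * (ST h ω : ℂ)‖}ᶜ := by
    ext ω
    simp
  rw [e, h2]
  have := min_le_left p 1
  linarith

theorem exists_measureReal_isSmallBand_le (hST : IsSatoTateSequence P ST) (A : ℝ) :
    ∃ p, 0 < p ∧ p ≤ 1 ∧ ∀ M : ℕ, 1 ≤ M → ∃ n₀ : ℕ, ∀ (s : Finset (ℕ × ℕ)) (t : ℝ),
      (∀ x ∈ s, n₀ ≤ x.1 ∧ x.2 < M) →
      P.real {ω | ∀ x ∈ s, IsSmallBand ST A M t ω x.1 x.2} ≤ (1 - p) ^ s.card := by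
  obtain ⟨p, hp, hp1, H⟩ := hST.exists_measureReal_norm_band_lt_le A
  refine ⟨p, hp, hp1, fun M hM => ?_⟩
  obtain ⟨k₀, hk₀⟩ := H M
  refine ⟨k₀, fun s t hs => ?_⟩
  refine hST.measureReal_iInter_norm_sum_lt_le s
    (fun x => band ((2 * M + 1) ^ x.1) (2 * (x.2 + 1) * (2 * M + 1) ^ x.1))
    (fun x => bandCoeff ((2 * M + 1) ^ x.1) (2 * (x.2 + 1) * (2 * M + 1) ^ x.1) t)
    (fun x => A * bandScale M ((2 * M + 1) ^ x.1))
    (fun x hx y hy hxy => disjoint_band (hs x hx).2 (hs y hy).2 hxy) fun x hx => ?_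
  have hpos : (0 : ℤ) < (2 * M + 1) ^ x.1 := by positivity
  have h2 : (x.2 : ℤ) + 1 ≤ M := by
    have := (hs x hx).2
    omega
  refine hk₀ _ _ t ((hs x hx).1.trans (Nat.lt_pow_self (by omega)).le) ?_ ?_
  · push_cast
    nlinarith [mul_nonneg (by omega : (0 : ℤ) ≤ (x.2 : ℤ)) hpos.le]
  · push_cast
    nlinarith [mul_nonneg (by omega : (0 : ℤ) ≤ (M : ℤ) - (x.2 + 1)) hpos.le]

/-- At a fixed point, the increments are almost surely not `O(|s - t|^{1/2})`. -/
theorem ae_not_hasSqrtBound (hST : IsSatoTateSequence P ST) {t : ℝ} (ht : t ∈ Icc (0 : ℝ) 1) :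
    ∀ᵐ ω ∂P, ∀ c δ : ℝ, 0 < c → 0 < δ → ¬ HasSqrtBound ST ω t c δ := by
  have h1 : ∀ A N : ℕ, ∀ᵐ ω ∂P, ¬ ∀ n, N ≤ n → IsSmallBand ST A 1 t ω n 0 := by
    intro A N
    obtain ⟨p, hp, hp1, H⟩ := hST.exists_measureReal_isSmallBand_le A
    obtain ⟨n₀, hn₀⟩ := H 1 le_rfl
    rw [ae_iff]
    simp only [not_not]
    have h2 : ∀ L : ℕ, P.real {ω | ∀ n, N ≤ n → IsSmallBand ST A 1 t ω n 0} ≤ (1 - p) ^ L := by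
      intro L
      let s : Finset (ℕ × ℕ) := (Finset.Ico (N + n₀) (N + n₀ + L)) ×ˢ {0}
      have hs : s.card = L := by simp [s]
      rw [← hs]
      refine le_trans (measureReal_mono fun ω hω => ?_) (hn₀ s t ?_)
      · intro x hx
        simp only [s, Finset.mem_product, Finset.mem_Ico, Finset.mem_singleton] at hx
        rw [hx.2]
        exact hω x.1 (by omega)
      · intro x hx
        simp only [s, Finset.mem_product, Finset.mem_Ico, Finset.mem_singleton] at hx
        omega
    have h3 : P.real {ω | ∀ n, N ≤ n → IsSmallBand ST A 1 t ω n 0} ≤ 0 :=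
      ge_of_tendsto' (tendsto_pow_atTop_nhds_zero_of_lt_one (by linarith) (by linarith)) h2
    exact (measureReal_eq_zero_iff).1 (le_antisymm h3 measureReal_nonneg)
  have h4 : ∀ᵐ ω ∂P, ∀ A N : ℕ, ¬ ∀ n, N ≤ n → IsSmallBand ST A 1 t ω n 0 :=
    ae_all_iff.2 fun A => ae_all_iff.2 fun N => h1 A N
  filter_upwards [h4, hST.ae_isRegularPath] with ω hω hreg c δ hc hδ hK
  obtain ⟨A, hA⟩ := exists_nat_gt (10 * c * (40 * (2 * ((1 : ℕ) : ℝ) + 1)))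
  obtain ⟨N, hN⟩ := exists_forall_isSmallBand hreg ht hc hδ hK le_rfl hA
  exact hω A N fun n hn => hN n hn 0 t (by simp)

/-- Almost surely, there is no point where the increments are `o(|s - t|^{1/2})`. -/
theorem exists_ae_not_hasSqrtBound (hST : IsSatoTateSequence P ST) :
    ∃ c, 0 < c ∧ ∀ᵐ ω ∂P, ∀ t ∈ Icc (0 : ℝ) 1, ∀ δ, 0 < δ → ¬ HasSqrtBound ST ω t c δ := by
  obtain ⟨p, hp, hp1, H⟩ := hST.exists_measureReal_isSmallBand_le 1
  have hq0 : 0 ≤ 1 - p := by linarith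
  have hq1 : 1 - p < 1 := by linarith
  obtain ⟨M, hM1, hM⟩ : ∃ M : ℕ, 1 ≤ M ∧ (2 * (M : ℝ) + 1) ^ 2 * (1 - p) ^ M < 1 := by
    have h1 := tendsto_pow_const_mul_const_pow_of_abs_lt_one 2
      (by rwa [abs_of_nonneg hq0] : |1 - p| < 1)
    have h2 := h1.const_mul 9
    rw [mul_zero] at h2
    obtain ⟨M, hM, hM'⟩ := ((h2.eventually_lt_const one_pos).and (eventually_ge_atTop 1)).exists
    refine ⟨M, hM', lt_of_le_of_lt ?_ hM⟩
    have hM1 : (1 : ℝ) ≤ M := by exact_mod_cast hM'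
    rw [← mul_assoc]
    gcongr
    nlinarith
  obtain ⟨n₀, hn₀⟩ := H M hM1
  set R := 2 * M + 1 with hR
  set ρ := (2 * (M : ℝ) + 1) ^ 2 * (1 - p) ^ M with hρ
  have hρ0 : 0 ≤ ρ := by positivity
  have hRR : (R : ℝ) = 2 * M + 1 := by rw [hR]; push_cast; ring
  let s : ℕ → Finset (ℕ × ℕ) := fun N => Finset.Ico N (2 * N) ×ˢ Finset.range M
  let E : ℕ → Set Ω := fun N => ⋃ g ∈ Finset.range (R ^ (2 * N) + 1),
    {ω | ∀ x ∈ s N, IsSmallBand ST 1 M ((g : ℝ) / (R : ℝ) ^ (2 * N)) ω x.1 x.2}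
  have hE (N : ℕ) (hN : n₀ ≤ N) : P.real (E N) ≤ 2 * ρ ^ N := by
    refine (measureReal_biUnion_finset_le _ _).trans ?_
    have hcard : (s N).card = N * M := by simp [s, two_mul]
    refine (Finset.sum_le_sum fun g _ => hn₀ (s N) _ fun x hx => ?_).trans ?_
    · simp only [s, Finset.mem_product, Finset.mem_Ico, Finset.mem_range] at hx
      omega
    · rw [Finset.sum_const, Finset.card_range, nsmul_eq_mul, hcard]
      push_cast
      have h1 : (1 : ℝ) ≤ (R : ℝ) ^ (2 * N) := one_le_pow₀ (by rw [hRR]; linarith)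
      have h2 : ρ ^ N = (R : ℝ) ^ (2 * N) * (1 - p) ^ (N * M) := by
        rw [hρ, hRR, mul_pow, ← pow_mul, ← pow_mul, mul_comm M N]
      rw [h2, ← mul_assoc]
      gcongr
      linarith
  have hsum : ∑' N, P (E (N + n₀)) ≠ ∞ := by
    have h1 : Summable fun N : ℕ => 2 * ρ ^ (N + n₀) :=
      ((summable_nat_add_iff n₀).2 (summable_geometric_of_lt_one hρ0 hM)).mul_left 2
    refine ne_top_of_le_ne_top (h1.tsum_ofReal_ne_top) (ENNReal.tsum_le_tsum fun N => ?_)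
    rw [← ENNReal.ofReal_toReal (measure_ne_top P (E (N + n₀)))]
    exact ENNReal.ofReal_le_ofReal (hE (N + n₀) (by omega))
  set c : ℝ := 1 / (800 * (2 * M + 1)) with hc
  have hcpos : 0 < c := by positivity
  have hcA : 10 * c * (40 * (2 * M + 1)) < 1 := by
    rw [hc]
    field_simp
    norm_num
  refine ⟨c, hcpos, ?_⟩
  filter_upwards [ae_eventually_notMem hsum, hST.ae_isRegularPath] with ω hω hreg t ht δ hδ hK
  obtain ⟨N₁, hN₁⟩ := eventually_atTop.1 hω
  obtain ⟨N₂, hN₂⟩ := exists_forall_isSmallBand hreg ht hcpos hδ hK hM1 hcA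
  set N := N₁ + N₂ + n₀ with hN
  refine hN₁ (N₁ + N₂) (by omega) ?_
  have hR1 : (1 : ℝ) ≤ R := by rw [hRR]; linarith
  have hRpos : (0 : ℝ) < (R : ℝ) ^ (2 * N) := by positivity
  set g := ⌊t * (R : ℝ) ^ (2 * N)⌋₊ with hg
  have hgle : (g : ℝ) ≤ t * (R : ℝ) ^ (2 * N) := Nat.floor_le (mul_nonneg ht.1 hRpos.le)
  have hglt : t * (R : ℝ) ^ (2 * N) < g + 1 := Nat.lt_floor_add_one _
  have hgR : g < R ^ (2 * N) + 1 := by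
    have : (g : ℝ) ≤ (R : ℝ) ^ (2 * N) := hgle.trans (by nlinarith [ht.2])
    have : g ≤ R ^ (2 * N) := by exact_mod_cast this
    omega
  simp only [E, mem_iUnion]
  refine ⟨g, Finset.mem_range.2 hgR, fun x hx => ?_⟩
  simp only [s, Finset.mem_product, Finset.mem_Ico, Finset.mem_range] at hx
  refine hN₂ x.1 (by omega) x.2 _ ?_
  have h1 : |(g : ℝ) / (R : ℝ) ^ (2 * N) - t| ≤ 1 / (R : ℝ) ^ (2 * N) := by
    have e : (g : ℝ) / (R : ℝ) ^ (2 * N) - t = (g - t * (R : ℝ) ^ (2 * N)) / (R : ℝ) ^ (2 * N) := by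
      field_simp
    rw [e, abs_div, abs_of_pos hRpos]
    gcongr
    rw [abs_le]
    constructor <;> linarith
  refine h1.trans ?_
  exact one_div_le_one_div_of_le (by positivity) (pow_le_pow_right₀ hR1 (by omega))

end IsSatoTateSequence

end KloostermanPaths

theorem proposition2p1 :
    -- the implied constant `C` is absolute: it is chosen before everything else
    ∃ C : ℝ, 0 < C ∧
      ∀ (Ω : Type*) [MeasurableSpace Ω] (P : Measure Ω) [IsProbabilityMeasure P]
        (ST : ℤ → Ω → ℝ), KloostermanPaths.IsSatoTateSequence P ST →
      (∀ t ∈ Icc (0 : ℝ) 1,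
        -- almost sure convergence
        (∀ᵐ ω ∂P, Tendsto (fun m : ℕ => KloostermanPaths.partialSum ST m t ω) atTop
          (𝓝 (KloostermanPaths.K ST t ω))) ∧
        -- convergence in law
        TendstoInDistribution (fun m : ℕ => KloostermanPaths.partialSum ST m t) atTop
          (KloostermanPaths.K ST t) (fun _ => P) P ∧
        -- convergence in `L^q` for `1 ≤ q < ∞`
        (∀ q : ℝ≥0∞, 1 ≤ q → q ≠ ∞ →
          (∀ m : ℕ, MemLp (KloostermanPaths.partialSum ST m t) q P) ∧
          MemLp (KloostermanPaths.K ST t) q P ∧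
          Tendsto (fun m : ℕ =>
            eLpNorm (KloostermanPaths.partialSum ST m t - KloostermanPaths.K ST t) q P)
            atTop (𝓝 0)) ∧
        -- the uniform bound for the partial sums
        (∀ m : ℕ, 2 ≤ m →
          eLpNorm (KloostermanPaths.partialSum ST m t) ∞ P ≤ ENNReal.ofReal (C * Real.log m)) ∧
        -- the rate of convergence in `L¹`
        (∀ m : ℕ, 1 ≤ m →
          Integrable (fun ω =>
            ‖KloostermanPaths.K ST t ω - KloostermanPaths.partialSum ST m t ω‖) P ∧
          ∫ ω, ‖KloostermanPaths.K ST t ω - KloostermanPaths.partialSum ST m t ω‖ ∂P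
            ≤ C * (m : ℝ) ^ (-(1 / 2) : ℝ)) ∧
        -- the Laplace transform is well-defined
        (∀ l ν : ℝ, 0 ≤ l → 0 ≤ ν →
          Integrable (fun ω => Real.exp
            (l * (KloostermanPaths.K ST t ω).re + ν * (KloostermanPaths.K ST t ω).im)) P) ∧
        -- moments of all orders
        (∀ k : ℕ, Integrable (fun ω => ‖KloostermanPaths.K ST t ω‖ ^ k) P)) ∧
      -- almost sure continuity
      (∀ᵐ ω ∂P, ContinuousOn (fun t => KloostermanPaths.K ST t ω) (Icc 0 1)) ∧
      -- almost surely nowhere differentiable (one-sided at the end points)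
      (∀ᵐ ω ∂P, ∀ t ∈ Icc (0 : ℝ) 1,
        ¬ DifferentiableWithinAt ℝ (fun s => KloostermanPaths.K ST s ω) (Icc 0 1) t) ∧
      -- almost surely Hölder continuous on `[0, 1]` of every order `α < 1/2`
      (∀ᵐ ω ∂P, ∀ α : ℝ≥0, 0 < α → α < 1 / 2 →
        ∃ c : ℝ≥0, HolderOnWith c α (fun t => KloostermanPaths.K ST t ω) (Icc 0 1)) ∧
      -- almost surely nowhere Hölder continuous of order `1/2`: on no nondegenerate interval
      (∀ᵐ ω ∂P, ∀ a b : ℝ, 0 ≤ a → a < b → b ≤ 1 →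
        ∀ c : ℝ≥0, ¬ HolderOnWith c (1 / 2) (fun t => KloostermanPaths.K ST t ω) (Icc a b)) ∧
      -- and at no point is the increment of smaller order than the square root
      (∀ᵐ ω ∂P, ∀ t ∈ Icc (0 : ℝ) 1,
        ¬ (fun s => KloostermanPaths.K ST s ω - KloostermanPaths.K ST t ω)
          =o[𝓝[Icc 0 1] t] fun s => |s - t| ^ (1 / 2 : ℝ)) := by
  have hM : 0 < KloostermanPaths.IsSatoTateSequence.momentConst 1 := by
    unfold KloostermanPaths.IsSatoTateSequence.momentConst
    positivity
  refine ⟨8 + KloostermanPaths.IsSatoTateSequence.momentConst 1, by positivity, ?_⟩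
  intro Ω _ P _ ST hST
  have hreg := hST.ae_isRegularPath
  obtain ⟨c₀, hc₀, hno⟩ := hST.exists_ae_not_hasSqrtBound
  have hlittle : ∀ᵐ ω ∂P, ∀ t ∈ Icc (0 : ℝ) 1,
      ¬ (fun s => KloostermanPaths.K ST s ω - KloostermanPaths.K ST t ω)
        =o[𝓝[Icc 0 1] t] fun s => |s - t| ^ (1 / 2 : ℝ) := by
    filter_upwards [hno] with ω hω t ht ho
    obtain ⟨δ, hδ, hK⟩ := KloostermanPaths.exists_hasSqrtBound_of_isLittleO ho hc₀
    exact hω t ht δ hδ hK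
  refine ⟨fun t ht => ?_, ?_, ?_, ?_, ?_, hlittle⟩
  · have hK : ∀ᵐ ω ∂P, Tendsto (fun m : ℕ => KloostermanPaths.partialSum ST m t ω) atTop
        (𝓝 (KloostermanPaths.K ST t ω)) := by
      filter_upwards [hreg] with ω hω using hω.tendsto t
    refine ⟨hK, hST.tendstoInDistribution hK, fun q _ hq => ⟨fun m => hST.memLp_partialSum m t q,
      hST.memLp_K hK hq, hST.tendsto_eLpNorm hK hq⟩, fun m hm => ?_, fun m hm =>
      ⟨hST.integrable_norm_K_sub hK m, ?_⟩, fun l ν _ _ => hST.integrable_exp_K hK l ν,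
      fun k => hST.integrable_norm_K_pow hK k⟩
    · refine (hST.eLpNorm_partialSum_top_le (abs_le.2 ⟨by linarith [ht.1], ht.2⟩) hm).trans
        (ENNReal.ofReal_le_ofReal ?_)
      have : 0 ≤ Real.log m := Real.log_natCast_nonneg m
      gcongr
      linarith
    · refine (hST.integral_norm_K_sub_le hK hm).trans ?_
      gcongr
      linarith
  · filter_upwards [hreg] with ω hω using hω.continuous.continuousOn
  · filter_upwards [hlittle] with ω hω t ht hd
    exact hω t ht (KloostermanPaths.isLittleO_of_differentiableWithinAt hd)
  · filter_upwards [hreg] with ω hω α hα hα2 using hω.holderOnWith hα hα2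
  · have hrat : ∀ᵐ ω ∂P, ∀ q : ℚ, (q : ℝ) ∈ Icc (0 : ℝ) 1 → ∀ c δ : ℝ, 0 < c → 0 < δ →
        ¬ KloostermanPaths.HasSqrtBound ST ω q c δ := by
      rw [ae_all_iff]
      intro q
      by_cases hq : (q : ℝ) ∈ Icc (0 : ℝ) 1
      · filter_upwards [hST.ae_not_hasSqrtBound hq] with ω hω _ using hω
      · exact ae_of_all _ fun ω h => absurd h hq
    filter_upwards [hrat] with ω hω a b ha hab hb c hc
    obtain ⟨q, hq1, hq2⟩ := exists_rat_btwn hab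
    obtain ⟨c', δ, hc', hδ, hK⟩ :=
      KloostermanPaths.exists_hasSqrtBound_of_holderOnWith ⟨hq1, hq2⟩ hc
    exact hω q ⟨by linarith, by linarith⟩ c' δ hc' hδ hK
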